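/- Let $G$ be a finite group and let $R$ be a commutative ring. A $G$-Mackey functor $M$ assigns to each finite $G$-set $X$ an abelian group $M(X)$, with restrictions $\mathrm{res}_f : M(Y) \to M(X)$ and transfers $\mathrm{tr}_f : M(X) \to M(Y)$ for each $G$-map $f : X \to Y$, both functorial, satisfying the base change (double coset) formula for pullback squares and taking finite disjoint unions to products. A (commutative) Green functor $k$ is a commutative monoid for the box product of Mackey functors, and a $k$-module is a Mackey functor with a unital associative action of $k$ (with respect to the box product). The category of $k$-modules is symmetric monoidal under the relative box product $\boxtimes_k$, with unit $k$. For an abelian group $V$, let $C_e^G V$ denote the Mackey functor $X \mapsto \mathrm{Fun}(X, V)$, whose restrictions are precomposition and whose transfers are summation along fibres (so $C_e^G V(G/H) = \mathrm{Fun}(G,V)^H$). Then $C_e^G R$, with pointwise multiplication, is a Green functor (the one underlying the Tambara functor coinduced from $R$), and for every $R$-module $V$ the Mackey functor $C_e^G V$, with pointwise action, is a $C_e^G R$-module. **Proposition.** The coinduction functor $V \mapsto C_e^G V$ is part of an adjoint equivalence between the category of $R$-modules and the category of $C_e^G R$-modules. Moreover, this adjoint equivalence is strong symmetric monoidal with respect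 to the tensor product $\otimes_R$ on $R$-modules and the relative box product $\boxtimes_{C_e^G R}$ on $C_e^G R$-modules: the coinduction functor and its inverse are strong symmetric monoidal functors, and the unit and counit of the equivalence are monoidal natural transformations. -/

import Mathlib

set_option linter.unusedSectionVars false

open CategoryTheory CategoryTheory.Limits MonoidalCategory

universe u v

/-! ### Mackey functors, Green functors and their modules -/

/-- A Mackey functor on `C` with values in abelian groups (in the sense of Dress): a covariant
functor (transfers `tr`) and a contravariant functor (restrictions `res`) which agree on objects,
satisfy base change (the double coset formula) for pullback squares, and take finite coproducts
to products. For `C` the category of finite `G`-sets these are the `G`-Mackey functors. -/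
structure MackeyFunctor (C : Type v) [Category.{0} C] where
  obj : C → Type u
  grp : ∀ X, AddCommGroup (obj X)
  res : ∀ {X Y : C}, (X ⟶ Y) → (obj Y →+ obj X)
  tr : ∀ {X Y : C}, (X ⟶ Y) → (obj X →+ obj Y)
  res_id : ∀ {X : C} (m : obj X), res (𝟙 X) m = m
  res_comp : ∀ {X Y Z : C} (f : X ⟶ Y) (g : Y ⟶ Z) (m : obj Z), res (f ≫ g) m = res f (res g m)
  tr_id : ∀ {X : C} (m : obj X), tr (𝟙 X) m = m
  tr_comp : ∀ {X Y Z : C} (f : X ⟶ Y) (g : Y ⟶ Z) (m : obj X), tr (f ≫ g) m = tr g (tr f m)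
  base_change : ∀ {W X Y Z : C} {p : W ⟶ X} {q : W ⟶ Y} {f : X ⟶ Z} {g : Y ⟶ Z},
    IsPullback p q f g → ∀ m : obj X, res g (tr f m) = tr q (res p m)
  subsingleton_initial : ∀ {X : C}, IsInitial X → Subsingleton (obj X)
  bijective_res : ∀ {X Y Z : C} (i : X ⟶ Z) (j : Y ⟶ Z), IsColimit (BinaryCofan.mk i j) →
    Function.Bijective (fun m : obj Z => (res i m, res j m))

attribute [instance] MackeyFunctor.grp

/-- A Dress pairing `L, M → N` of Mackey functors, that is, a map `L □ M ⟶ N` out of the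
box product: levelwise biadditive maps compatible with restrictions and satisfying
Frobenius reciprocity in each variable. -/
structure MackeyFunctor.Pairing {C : Type v} [Category.{0} C] (L M N : MackeyFunctor.{u} C) where
  app : ∀ X, L.obj X →+ M.obj X →+ N.obj X
  res_app : ∀ {X Y : C} (f : X ⟶ Y) (l : L.obj Y) (m : M.obj Y),
    N.res f (app Y l m) = app X (L.res f l) (M.res f m)
  tr_left : ∀ {X Y : C} (f : X ⟶ Y) (l : L.obj X) (m : M.obj Y),
    app Y (L.tr f l) m = N.tr f (app X l (M.res f m))
  tr_right : ∀ {X Y : C} (f : X ⟶ Y) (l : L.obj Y) (m : M.obj X),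
    app Y l (M.tr f m) = N.tr f (app X (L.res f l) m)

/-- A (commutative) Green functor: a commutative monoid for the box product of Mackey functors.
Equivalently, each `k.obj X` is a commutative ring, restrictions are ring homomorphisms, and
transfers are module homomorphisms. -/
structure GreenFunctor (C : Type v) [Category.{0} C] extends MackeyFunctor.{u} C where
  mul : MackeyFunctor.Pairing toMackeyFunctor toMackeyFunctor toMackeyFunctor
  one : ∀ X, obj X
  res_one : ∀ {X Y : C} (f : X ⟶ Y), res f (one Y) = one X
  one_mul : ∀ {X : C} (a : obj X), mul.app X (one X) a = a
  mul_comm : ∀ {X : C} (a b : obj X), mul.app X a b = mul.app X b a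
  mul_assoc : ∀ {X : C} (a b c : obj X),
    mul.app X (mul.app X a b) c = mul.app X a (mul.app X b c)

/-- A (Mackey functor) module over a Green functor `k`: a Mackey functor with a unital,
associative action `k □ M ⟶ M`. -/
structure GreenModule {C : Type v} [Category.{0} C] (k : GreenFunctor.{u} C) extends
    MackeyFunctor.{u} C where
  act : MackeyFunctor.Pairing k.toMackeyFunctor toMackeyFunctor toMackeyFunctor
  one_act : ∀ {X : C} (m : obj X), act.app X (k.one X) m = m
  mul_act : ∀ {X : C} (a b : k.obj X) (m : obj X),
    act.app X (k.mul.app X a b) m = act.app X a (act.app X b m)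

namespace MackeyFunctor

variable {C : Type v} [Category.{0} C] (M : MackeyFunctor.{u} C)

theorem res_tr_mono {X Y : C} (f : X ⟶ Y) [Mono f] (m : M.obj X) : M.res f (M.tr f m) = m := by
  rw [M.base_change (IsKernelPair.id_of_mono f), M.res_id, M.tr_id]

theorem tr_res_iso {X Y : C} (e : X ≅ Y) (m : M.obj Y) : M.tr e.hom (M.res e.hom m) = m := by
  have h : ∀ z, M.tr e.hom z = M.res e.inv z := fun z => by
    have h1 := congrArg (M.res e.inv) (M.res_tr_mono e.hom z)
    rwa [← M.res_comp, e.inv_hom_id, M.res_id] at h1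
  rw [h, ← M.res_comp, e.inv_hom_id, M.res_id]

theorem tr_hom_eq_res_inv {X Y : C} (e : X ≅ Y) (m : M.obj X) : M.tr e.hom m = M.res e.inv m := by
  conv_lhs => rw [← M.res_id m, ← e.hom_inv_id, M.res_comp]
  rw [tr_res_iso]

theorem res_tr_disjoint [FinitaryExtensive C] {X Y Z : C} (i : X ⟶ Z) (j : Y ⟶ Z)
    (h : IsColimit (BinaryCofan.mk i j)) (m : M.obj X) : M.res j (M.tr i m) = 0 := by
  have hp : IsPullback (initial.to X) (initial.to Y) i j :=
    FinitaryExtensive.isPullback_initial_to_binaryCofan h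
  have := M.subsingleton_initial (initialIsInitial (C := C))
  rw [M.base_change hp, Subsingleton.elim (M.res (initial.to X) m) 0, map_zero]

theorem isColimit_swap {X Y Z : C} {i : X ⟶ Z} {j : Y ⟶ Z}
    (h : IsColimit (BinaryCofan.mk i j)) : Nonempty (IsColimit (BinaryCofan.mk j i)) :=
  ⟨BinaryCofan.isColimitFlip h⟩

theorem tr_res_add [FinitaryExtensive C] {X Y Z : C} (i : X ⟶ Z) (j : Y ⟶ Z)
    (h : IsColimit (BinaryCofan.mk i j)) (m : M.obj Z) :
    M.tr i (M.res i m) + M.tr j (M.res j m) = m := by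
  have : Mono i := FinitaryExtensive.mono_inl_of_isColimit h
  have : Mono j := FinitaryExtensive.mono_inr_of_isColimit h
  obtain ⟨h'⟩ := isColimit_swap h
  apply (M.bijective_res i j h).1
  simp [res_tr_mono, M.res_tr_disjoint i j h, M.res_tr_disjoint j i h']

end MackeyFunctor

namespace GreenModule

section Hom

variable {C : Type v} [Category.{0} C] {k : GreenFunctor.{u} C}

/-- Morphisms of modules over a Green functor: levelwise linear maps commuting with
restrictions and transfers. -/
@[ext]
structure Hom (M N : GreenModule k) where
  app : ∀ X, M.obj X →+ N.obj X
  app_res : ∀ {X Y : C} (f : X ⟶ Y) (m : M.obj Y), app X (M.res f m) = N.res f (app Y m)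
  app_tr : ∀ {X Y : C} (f : X ⟶ Y) (m : M.obj X), app Y (M.tr f m) = N.tr f (app X m)
  app_act : ∀ {X : C} (a : k.obj X) (m : M.obj X),
    app X (M.act.app X a m) = N.act.app X a (app X m)

instance : Category (GreenModule k) where
  Hom := Hom
  id M := ⟨fun X => AddMonoidHom.id _, fun _ _ => rfl, fun _ _ => rfl, fun _ _ => rfl⟩
  comp f g := ⟨fun X => (g.app X).comp (f.app X),
    fun h m => by simp [f.app_res, g.app_res], fun h m => by simp [f.app_tr, g.app_tr],
    fun a m => by simp [f.app_act, g.app_act]⟩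

@[simp] theorem id_app (M : GreenModule k) (X : C) (m : M.obj X) : Hom.app (𝟙 M) X m = m := rfl

@[simp] theorem comp_app {L M N : GreenModule k} (f : L ⟶ M) (g : M ⟶ N) (X : C) (l : L.obj X) :
    Hom.app (f ≫ g) X l = Hom.app g X (Hom.app f X l) := rfl

theorem hom_ext {M N : GreenModule k} {f g : M ⟶ N}
    (h : ∀ X (m : M.obj X), Hom.app f X m = Hom.app g X m) : f = g :=
  Hom.ext (funext fun X => AddMonoidHom.ext (h X))

/-- A Green functor as a module over itself. -/
def unit (k : GreenFunctor.{u} C) : GreenModule k where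
  toMackeyFunctor := k.toMackeyFunctor
  act := k.mul
  one_act := k.one_mul
  mul_act := k.mul_assoc

end Hom

/-! ### The relative box product -/

section Box

variable {C : Type v} [Category.{0} C] [EssentiallySmall.{0} C] {k : GreenFunctor.{u} C}

/-- The small set of objects used to index the generators of the box product. -/
noncomputable abbrev smallObj (Y : SmallModel.{0} C) : C := (equivSmallModel C).inverse.obj Y

variable (M N : GreenModule k) (X : C)

/-- Generators `tr_f (m ⊗ n)` of `(M □_k N)(X)`: here `f : Y ⟶ X`, `m ∈ M(Y)` and `n ∈ N(Y)`,
with `Y` in a set of representatives of the objects of `C`. -/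
def BoxGen : Type u :=
  Σ Y : SmallModel.{0} C, (smallObj Y ⟶ X) × M.obj (smallObj Y) × N.obj (smallObj Y)

variable {M N X} in
/-- The generator `tr_f (m ⊗ n)`. -/
noncomputable def boxGen (Y : SmallModel.{0} C) (f : smallObj Y ⟶ X) (m : M.obj (smallObj Y))
    (n : N.obj (smallObj Y)) : FreeAbelianGroup (BoxGen M N X) :=
  FreeAbelianGroup.of ⟨Y, f, m, n⟩

/-- The relations of `(M □_k N)(X)`. The relations `add_left`, `add_right`, `frob_left` and
`frob_right` present the box product of the underlying Mackey functors (the coend formula);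
`balanced` imposes `a m ⊗ n = m ⊗ a n`, i.e. passes to the coequalizer of the two
maps `M □ k □ N ⟶ M □ N`. -/
inductive BoxRel : FreeAbelianGroup (BoxGen M N X) → Prop
  | add_left (Y) (f : smallObj Y ⟶ X) (m m' n) :
      BoxRel (boxGen Y f (m + m') n - (boxGen Y f m n + boxGen Y f m' n))
  | add_right (Y) (f : smallObj Y ⟶ X) (m n n') :
      BoxRel (boxGen Y f m (n + n') - (boxGen Y f m n + boxGen Y f m n'))
  | balanced (Y) (f : smallObj Y ⟶ X) (a m n) :
      BoxRel (boxGen Y f (M.act.app _ a m) n - boxGen Y f m (N.act.app _ a n))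
  | frob_left (Y Y') (h : smallObj Y' ⟶ smallObj Y) (f : smallObj Y ⟶ X) (m n) :
      BoxRel (boxGen Y f (M.tr h m) n - boxGen Y' (h ≫ f) m (N.res h n))
  | frob_right (Y Y') (h : smallObj Y' ⟶ smallObj Y) (f : smallObj Y ⟶ X) (m n) :
      BoxRel (boxGen Y f m (N.tr h n) - boxGen Y' (h ≫ f) (M.res h m) n)

/-- The abelian group `(M □_k N)(X)`. -/
def BoxObj : Type u :=
  FreeAbelianGroup (BoxGen M N X) ⧸ AddSubgroup.closure {z | BoxRel M N X z}

noncomputable instance : AddCommGroup (BoxObj M N X) :=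
  inferInstanceAs (AddCommGroup (_ ⧸ AddSubgroup.closure {z | BoxRel M N X z}))

variable {M N X}

/-- The class of `tr_f (m ⊗ n)` for a representative `Y`. -/
noncomputable def boxMk (Y : SmallModel.{0} C) (f : smallObj Y ⟶ X) (m : M.obj (smallObj Y))
    (n : N.obj (smallObj Y)) : BoxObj M N X :=
  QuotientAddGroup.mk (boxGen Y f m n)

theorem boxMk_rel {z : FreeAbelianGroup (BoxGen M N X)} (h : BoxRel M N X z) :
    (QuotientAddGroup.mk z : FreeAbelianGroup (BoxGen M N X) ⧸
      AddSubgroup.closure {z | BoxRel M N X z}) = 0 :=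
  (QuotientAddGroup.eq_zero_iff z).2 (AddSubgroup.subset_closure h)

/-- A chosen isomorphism from `Y` to its representative. -/
noncomputable def smallIso (Y : C) : Y ≅ smallObj ((equivSmallModel C).functor.obj Y) :=
  (equivSmallModel C).unitIso.app Y

/-- The class of `tr_f (m ⊗ n)` for an arbitrary object `Y`. -/
noncomputable def boxTr {Y : C} (f : Y ⟶ X) (m : M.obj Y) (n : N.obj Y) : BoxObj M N X :=
  boxMk ((equivSmallModel C).functor.obj Y) ((smallIso Y).inv ≫ f)
    (M.res (smallIso Y).inv m) (N.res (smallIso Y).inv n)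

theorem boxMk_frob_left (Y Y' : SmallModel.{0} C) (h : smallObj Y' ⟶ smallObj Y)
    (f : smallObj Y ⟶ X) (m : M.obj (smallObj Y')) (n : N.obj (smallObj Y)) :
    boxMk Y f (M.tr h m) n = boxMk Y' (h ≫ f) m (N.res h n) :=
  sub_eq_zero.1 (boxMk_rel (BoxRel.frob_left Y Y' h f m n))

theorem boxMk_frob_right (Y Y' : SmallModel.{0} C) (h : smallObj Y' ⟶ smallObj Y)
    (f : smallObj Y ⟶ X) (m : M.obj (smallObj Y)) (n : N.obj (smallObj Y')) :
    boxMk Y f m (N.tr h n) = boxMk Y' (h ≫ f) (M.res h m) n :=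
  sub_eq_zero.1 (boxMk_rel (BoxRel.frob_right Y Y' h f m n))

theorem boxTr_add_left {Y : C} (f : Y ⟶ X) (m m' : M.obj Y) (n : N.obj Y) :
    boxTr f (m + m') n = boxTr f m n + boxTr f m' n := by
  simp only [boxTr, map_add]
  exact sub_eq_zero.1 (boxMk_rel (BoxRel.add_left _ _ _ _ _))

theorem boxTr_add_right {Y : C} (f : Y ⟶ X) (m : M.obj Y) (n n' : N.obj Y) :
    boxTr f m (n + n') = boxTr f m n + boxTr f m n' := by
  simp only [boxTr, map_add]
  exact sub_eq_zero.1 (boxMk_rel (BoxRel.add_right _ _ _ _ _))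

theorem boxTr_balanced {Y : C} (f : Y ⟶ X) (a : k.obj Y) (m : M.obj Y) (n : N.obj Y) :
    boxTr f (M.act.app Y a m) n = boxTr f m (N.act.app Y a n) := by
  simp only [boxTr, M.act.res_app, N.act.res_app]
  exact sub_eq_zero.1 (boxMk_rel (BoxRel.balanced _ _ _ _ _))

theorem tr_smallIso (P : MackeyFunctor.{u} C) {Y' Y : C} (h : Y' ⟶ Y) (m : P.obj Y') :
    P.tr ((smallIso Y').inv ≫ h ≫ (smallIso Y).hom) (P.res (smallIso Y').inv m) =
      P.res (smallIso Y).inv (P.tr h m) := by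
  rw [P.tr_comp, P.tr_comp, P.tr_hom_eq_res_inv]
  exact congrArg _ (congrArg _ (P.tr_res_iso (smallIso Y').symm m))

theorem res_smallIso (P : MackeyFunctor.{u} C) {Y' Y : C} (h : Y' ⟶ Y) (m : P.obj Y) :
    P.res ((smallIso Y').inv ≫ h ≫ (smallIso Y).hom) (P.res (smallIso Y).inv m) =
      P.res (smallIso Y').inv (P.res h m) := by
  rw [← P.res_comp, ← P.res_comp]
  simp

theorem boxTr_frob_left {Y Y' : C} (h : Y' ⟶ Y) (f : Y ⟶ X) (m : M.obj Y') (n : N.obj Y) :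
    boxTr f (M.tr h m) n = boxTr (h ≫ f) m (N.res h n) := by
  simp only [boxTr]
  rw [← tr_smallIso, ← res_smallIso N.toMackeyFunctor, boxMk_frob_left]
  simp

theorem boxTr_frob_right {Y Y' : C} (h : Y' ⟶ Y) (f : Y ⟶ X) (m : M.obj Y) (n : N.obj Y') :
    boxTr f m (N.tr h n) = boxTr (h ≫ f) (M.res h m) n := by
  simp only [boxTr]
  rw [← tr_smallIso, ← res_smallIso M.toMackeyFunctor, boxMk_frob_right]
  simp

theorem boxTr_iso {Y Y' : C} (e : Y' ≅ Y) (f : Y ⟶ X) (m : M.obj Y) (n : N.obj Y) :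
    boxTr (e.hom ≫ f) (M.res e.hom m) (N.res e.hom n) = boxTr f m n := by
  rw [← boxTr_frob_left, M.tr_res_iso]

theorem boxMk_eq_boxTr (Y : SmallModel.{0} C) (f : smallObj Y ⟶ X) (m : M.obj (smallObj Y))
    (n : N.obj (smallObj Y)) : boxMk Y f m n = boxTr f m n := by
  rw [boxTr, ← boxMk_frob_left]
  exact congrArg (fun z => boxMk Y f z n) (M.tr_res_iso (smallIso (smallObj Y)).symm m).symm

@[elab_as_elim]
theorem box_induction {motive : BoxObj M N X → Prop} (z : BoxObj M N X) (zero : motive 0)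
    (of : ∀ (Y : C) (f : Y ⟶ X) (m : M.obj Y) (n : N.obj Y), motive (boxTr f m n))
    (neg : ∀ z, motive z → motive (-z))
    (add : ∀ z w, motive z → motive w → motive (z + w)) : motive z := by
  induction z using QuotientAddGroup.induction_on with
  | H z =>
    induction z using FreeAbelianGroup.induction_on with
    | zero => exact zero
    | of x =>
      obtain ⟨Y, f, m, n⟩ := x
      have h := of (smallObj Y) f m n
      rwa [← boxMk_eq_boxTr] at h
    | neg x hx => exact neg _ hx
    | add x y hx hy => exact add _ _ hx hy

theorem box_hom_ext {A : Type*} [AddCommGroup A] {φ ψ : BoxObj M N X →+ A}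
    (h : ∀ (Y : C) (f : Y ⟶ X) (m : M.obj Y) (n : N.obj Y), φ (boxTr f m n) = ψ (boxTr f m n)) :
    φ = ψ := by
  ext z
  induction z using box_induction with
  | zero => simp
  | of Y f m n => exact h Y f m n
  | neg z hz => simp [hz]
  | add z w hz hw => simp [hz, hw]

/-- Data for a homomorphism out of `(M □_k N)(X)`. -/
structure BoxCocone (M N : GreenModule k) (X : C) (A : Type u) [AddCommGroup A] where
  toFun : ∀ {Y : C}, (Y ⟶ X) → M.obj Y → N.obj Y → A
  add_left : ∀ {Y : C} (f : Y ⟶ X) (m m' : M.obj Y) (n : N.obj Y),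
    toFun f (m + m') n = toFun f m n + toFun f m' n
  add_right : ∀ {Y : C} (f : Y ⟶ X) (m : M.obj Y) (n n' : N.obj Y),
    toFun f m (n + n') = toFun f m n + toFun f m n'
  balanced : ∀ {Y : C} (f : Y ⟶ X) (a : k.obj Y) (m : M.obj Y) (n : N.obj Y),
    toFun f (M.act.app Y a m) n = toFun f m (N.act.app Y a n)
  frob_left : ∀ {Y Y' : C} (h : Y' ⟶ Y) (f : Y ⟶ X) (m : M.obj Y') (n : N.obj Y),
    toFun f (M.tr h m) n = toFun (h ≫ f) m (N.res h n)
  frob_right : ∀ {Y Y' : C} (h : Y' ⟶ Y) (f : Y ⟶ X) (m : M.obj Y) (n : N.obj Y'),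
    toFun f m (N.tr h n) = toFun (h ≫ f) (M.res h m) n

/-- The homomorphism out of the free abelian group on generators. -/
noncomputable def BoxCocone.free {A : Type u} [AddCommGroup A] (c : BoxCocone M N X A) :
    FreeAbelianGroup (BoxGen M N X) →+ A :=
  FreeAbelianGroup.lift fun x => c.toFun x.2.1 x.2.2.1 x.2.2.2

theorem BoxCocone.free_boxGen {A : Type u} [AddCommGroup A] (c : BoxCocone M N X A)
    (Y : SmallModel.{0} C) (f : smallObj Y ⟶ X) (m : M.obj (smallObj Y))
    (n : N.obj (smallObj Y)) : c.free (boxGen Y f m n) = c.toFun f m n :=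
  FreeAbelianGroup.lift_apply_of _ _

/-- The homomorphism out of `(M □_k N)(X)` determined by its values on generators. -/
noncomputable def BoxCocone.desc {A : Type u} [AddCommGroup A] (c : BoxCocone M N X A) :
    BoxObj M N X →+ A :=
  QuotientAddGroup.lift _ c.free <| by
    rw [AddSubgroup.closure_le]
    rintro z (⟨Y, f, m, m', n⟩ | ⟨Y, f, m, n, n'⟩ | ⟨Y, f, a, m, n⟩ | ⟨Y, Y', h, f, m, n⟩ |
      ⟨Y, Y', h, f, m, n⟩)
    · simp [c.free_boxGen, c.add_left]
    · simp [c.free_boxGen, c.add_right]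
    · simp [c.free_boxGen, c.balanced]
    · simp [c.free_boxGen, c.frob_left]
    · simp [c.free_boxGen, c.frob_right]

theorem BoxCocone.desc_boxTr {A : Type u} [AddCommGroup A] (c : BoxCocone M N X A) {Y : C}
    (f : Y ⟶ X) (m : M.obj Y) (n : N.obj Y) : c.desc (boxTr f m n) = c.toFun f m n := by
  have h : c.desc (boxTr f m n) = c.toFun ((smallIso Y).inv ≫ f) (M.res (smallIso Y).inv m)
      (N.res (smallIso Y).inv n) := c.free_boxGen _ _ _ _
  rw [h, ← c.frob_left]
  exact congrArg (fun z => c.toFun f z n) (M.tr_res_iso (smallIso Y).symm m)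

theorem boxTr_zero_left {Y : C} (f : Y ⟶ X) (n : N.obj Y) : boxTr f (0 : M.obj Y) n = 0 := by
  have h := boxTr_add_left f (0 : M.obj Y) 0 n
  simpa using h

/-- Transfers of the box product. -/
noncomputable def boxTransfer {X' : C} (g : X ⟶ X') : BoxObj M N X →+ BoxObj M N X' :=
  BoxCocone.desc
    { toFun := fun f m n => boxTr (f ≫ g) m n
      add_left := fun f m m' n => boxTr_add_left _ _ _ _
      add_right := fun f m n n' => boxTr_add_right _ _ _ _
      balanced := fun f a m n => boxTr_balanced _ _ _ _
      frob_left := fun h f m n => by rw [boxTr_frob_left, Category.assoc]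
      frob_right := fun h f m n => by rw [boxTr_frob_right, Category.assoc] }

@[simp] theorem boxTransfer_boxTr {X' Y : C} (g : X ⟶ X') (f : Y ⟶ X) (m : M.obj Y)
    (n : N.obj Y) : boxTransfer g (boxTr f m n) = boxTr (f ≫ g) m n :=
  BoxCocone.desc_boxTr _ _ _ _

theorem boxTr_pullback_unique {Y X' P Q : C} {f : Y ⟶ X} {g : X' ⟶ X} {p : P ⟶ Y} {q : P ⟶ X'}
    (hP : IsPullback p q f g) {p' : Q ⟶ Y} {q' : Q ⟶ X'} (hQ : IsPullback p' q' f g)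
    (m : M.obj Y) (n : N.obj Y) :
    boxTr q (M.res p m) (N.res p n) = boxTr q' (M.res p' m) (N.res p' n) := by
  rw [← boxTr_iso (hQ.isoIsPullback _ _ hP) q, ← M.res_comp, ← N.res_comp]
  simp

variable [HasPullbacks C]

/-- Restrictions of the box product, given by the double coset formula. -/
noncomputable def boxRestrict {X' : C} (g : X' ⟶ X) : BoxObj M N X →+ BoxObj M N X' :=
  BoxCocone.desc
    { toFun := fun f m n =>
        boxTr (pullback.snd f g) (M.res (pullback.fst f g) m) (N.res (pullback.fst f g) n)
      add_left := fun f m m' n => by rw [map_add, boxTr_add_left]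
      add_right := fun f m n n' => by rw [map_add, boxTr_add_right]
      balanced := fun f a m n => by rw [M.act.res_app, N.act.res_app, boxTr_balanced]
      frob_left := fun {Y Y'} h f m n => by
        have hp : IsPullback (pullback.fst h (pullback.fst f g)) (pullback.snd h (pullback.fst f g))
            h (pullback.fst f g) := .of_hasPullback _ _
        have hq := hp.flip.paste_horiz (IsPullback.of_hasPullback f g).flip
        rw [M.base_change hp, boxTr_frob_left,
          boxTr_pullback_unique (IsPullback.of_hasPullback (h ≫ f) g) hq.flip, ← N.res_comp,
          ← N.res_comp, hp.w]
      frob_right := fun {Y Y'} h f m n => by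
        have hp : IsPullback (pullback.fst h (pullback.fst f g)) (pullback.snd h (pullback.fst f g))
            h (pullback.fst f g) := .of_hasPullback _ _
        have hq := hp.flip.paste_horiz (IsPullback.of_hasPullback f g).flip
        rw [N.base_change hp, boxTr_frob_right,
          boxTr_pullback_unique (IsPullback.of_hasPullback (h ≫ f) g) hq.flip, ← M.res_comp,
          ← M.res_comp, hp.w] }

theorem boxRestrict_boxTr {X' Y P : C} {g : X' ⟶ X} {f : Y ⟶ X} {p : P ⟶ Y} {q : P ⟶ X'}
    (hP : IsPullback p q f g) (m : M.obj Y) (n : N.obj Y) :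
    boxRestrict g (boxTr f m n) = boxTr q (M.res p m) (N.res p n) :=
  (BoxCocone.desc_boxTr _ _ _ _).trans (boxTr_pullback_unique (.of_hasPullback f g) hP m n)


/-- The action of `k(X)` on `(M □_k N)(X)`: `a • tr_f (m ⊗ n) = tr_f (f^* a • m ⊗ n)`. -/
noncomputable def boxAct (M N : GreenModule k) (X : C) :
    k.obj X →+ BoxObj M N X →+ BoxObj M N X :=
  AddMonoidHom.mk' (fun a => BoxCocone.desc
    { toFun := fun {Y} f m n => boxTr f (M.act.app Y (k.res f a) m) n
      add_left := fun f m m' n => by rw [map_add, boxTr_add_left]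
      add_right := fun f m n n' => boxTr_add_right _ _ _ _
      balanced := fun f b m n => by
        rw [← M.mul_act, k.mul_comm, M.mul_act, boxTr_balanced]
      frob_left := fun h f m n => by
        rw [M.act.tr_right, boxTr_frob_left, ← k.res_comp]
      frob_right := fun h f m n => by
        rw [boxTr_frob_right, M.act.res_app, ← k.res_comp] }) fun a b => by
    apply box_hom_ext
    intro Y f m n
    simp only [AddMonoidHom.add_apply, BoxCocone.desc_boxTr, map_add, boxTr_add_left]

theorem boxAct_boxTr {Y : C} (a : k.obj X) (f : Y ⟶ X) (m : M.obj Y) (n : N.obj Y) :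
    boxAct M N X a (boxTr f m n) = boxTr f (M.act.app Y (k.res f a) m) n :=
  BoxCocone.desc_boxTr _ _ _ _

theorem boxTransfer_comp_apply {X' X'' : C} (g : X ⟶ X') (h : X' ⟶ X'') (z : BoxObj M N X) :
    boxTransfer (g ≫ h) z = boxTransfer h (boxTransfer g z) := by
  refine DFunLike.congr_fun (f := boxTransfer (g ≫ h))
    (g := (boxTransfer h).comp (boxTransfer g)) (box_hom_ext fun Y f m n => ?_) z
  simp

theorem boxRestrict_comp_apply {X' X'' : C} (g : X'' ⟶ X') (h : X' ⟶ X) (z : BoxObj M N X) :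
    boxRestrict (g ≫ h) z = boxRestrict g (boxRestrict h z) := by
  refine DFunLike.congr_fun (f := boxRestrict (g ≫ h))
    (g := (boxRestrict g).comp (boxRestrict h)) (box_hom_ext fun Y f m n => ?_) z
  have h1 := IsPullback.of_hasPullback f h
  have h2 := IsPullback.of_hasPullback (pullback.snd f h) g
  have h3 := h2.flip.paste_vert h1.flip
  rw [AddMonoidHom.comp_apply, boxRestrict_boxTr h1, boxRestrict_boxTr h2,
    boxRestrict_boxTr h3.flip, M.res_comp, N.res_comp]

theorem box_base_change {W X Y Z : C} {p : W ⟶ X} {q : W ⟶ Y} {f : X ⟶ Z} {g : Y ⟶ Z}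
    (h : IsPullback p q f g) (z : BoxObj M N X) :
    boxRestrict g (boxTransfer f z) = boxTransfer q (boxRestrict p z) := by
  refine DFunLike.congr_fun (f := (boxRestrict g).comp (boxTransfer f))
    (g := (boxTransfer q).comp (boxRestrict p)) (box_hom_ext fun U u m n => ?_) z
  have h1 := IsPullback.of_hasPullback u p
  have h2 := h1.flip.paste_horiz h.flip
  rw [AddMonoidHom.comp_apply, AddMonoidHom.comp_apply, boxTransfer_boxTr, boxRestrict_boxTr h1,
    boxTransfer_boxTr, boxRestrict_boxTr h2.flip]

theorem boxRestrict_id_apply (z : BoxObj M N X) : boxRestrict (𝟙 X) z = z := by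
  refine DFunLike.congr_fun (f := boxRestrict (𝟙 X)) (g := AddMonoidHom.id _)
    (box_hom_ext fun Y f m n => ?_) z
  rw [boxRestrict_boxTr (IsPullback.of_horiz_isIso ⟨by simp⟩ : IsPullback (𝟙 Y) f f (𝟙 X)),
    M.res_id, N.res_id]
  rfl

theorem boxTransfer_id_apply (z : BoxObj M N X) : boxTransfer (𝟙 X) z = z := by
  refine DFunLike.congr_fun (f := boxTransfer (𝟙 X)) (g := AddMonoidHom.id _)
    (box_hom_ext fun Y f m n => ?_) z
  simp

theorem boxRestrict_boxAct {X' : C} (g : X' ⟶ X) (a : k.obj X) (z : BoxObj M N X) :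
    boxRestrict g (boxAct M N X a z) = boxAct M N X' (k.res g a) (boxRestrict g z) := by
  refine DFunLike.congr_fun (f := (boxRestrict g).comp (boxAct M N X a))
    (g := (boxAct M N X' (k.res g a)).comp (boxRestrict g)) (box_hom_ext fun Y f m n => ?_) z
  have h := IsPullback.of_hasPullback f g
  rw [AddMonoidHom.comp_apply, AddMonoidHom.comp_apply, boxAct_boxTr, boxRestrict_boxTr h,
    boxRestrict_boxTr h, boxAct_boxTr, M.act.res_app, ← k.res_comp, ← k.res_comp, h.w]

theorem boxAct_tr_left {X' : C} (g : X' ⟶ X) (a : k.obj X') (z : BoxObj M N X) :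
    boxAct M N X (k.tr g a) z = boxTransfer g (boxAct M N X' a (boxRestrict g z)) := by
  refine DFunLike.congr_fun (f := boxAct M N X (k.tr g a))
    (g := (boxTransfer g).comp ((boxAct M N X' a).comp (boxRestrict g)))
    (box_hom_ext fun Y f m n => ?_) z
  have h := IsPullback.of_hasPullback f g
  rw [AddMonoidHom.comp_apply, AddMonoidHom.comp_apply, boxAct_boxTr, boxRestrict_boxTr h,
    boxAct_boxTr, boxTransfer_boxTr, k.base_change h.flip, M.act.tr_left, boxTr_frob_left, h.w]

theorem boxAct_tr_right {X' : C} (g : X' ⟶ X) (a : k.obj X) (z : BoxObj M N X') :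
    boxAct M N X a (boxTransfer g z) = boxTransfer g (boxAct M N X' (k.res g a) z) := by
  refine DFunLike.congr_fun (f := (boxAct M N X a).comp (boxTransfer g))
    (g := (boxTransfer g).comp (boxAct M N X' (k.res g a))) (box_hom_ext fun Y f m n => ?_) z
  rw [AddMonoidHom.comp_apply, AddMonoidHom.comp_apply, boxAct_boxTr, boxTransfer_boxTr,
    boxAct_boxTr, boxTransfer_boxTr, k.res_comp]

theorem boxAct_one (z : BoxObj M N X) : boxAct M N X (k.one X) z = z := by
  refine DFunLike.congr_fun (f := boxAct M N X (k.one X)) (g := AddMonoidHom.id _)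
    (box_hom_ext fun Y f m n => ?_) z
  rw [boxAct_boxTr, k.res_one, M.one_act]
  rfl

theorem boxAct_mul (a b : k.obj X) (z : BoxObj M N X) :
    boxAct M N X (k.mul.app X a b) z = boxAct M N X a (boxAct M N X b z) := by
  refine DFunLike.congr_fun (f := boxAct M N X (k.mul.app X a b))
    (g := (boxAct M N X a).comp (boxAct M N X b)) (box_hom_ext fun Y f m n => ?_) z
  rw [AddMonoidHom.comp_apply, boxAct_boxTr, boxAct_boxTr, boxAct_boxTr, k.mul.res_app, M.mul_act]

variable [FinitaryExtensive C]

theorem box_subsingleton_initial (h : IsInitial X) : Subsingleton (BoxObj M N X) := by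
  have key : ∀ z : BoxObj M N X, z = 0 := fun z => by
    refine DFunLike.congr_fun (f := AddMonoidHom.id _) (g := 0)
      (box_hom_ext fun Y f m n => ?_) z
    have : IsIso f := h.isIso_to f
    have := M.subsingleton_initial (h.ofIso (asIso f).symm)
    rw [Subsingleton.elim m 0]
    exact boxTr_zero_left f n
  exact ⟨fun a b => (key a).trans (key b).symm⟩

theorem isColimit_pullback {X Y Z U : C} {i : X ⟶ Z} {j : Y ⟶ Z}
    (h : IsColimit (BinaryCofan.mk i j)) (f : U ⟶ Z) :
    Nonempty (IsColimit (BinaryCofan.mk (pullback.fst f i) (pullback.fst f j))) :=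
  ((BinaryCofan.isVanKampen_iff _).1 (FinitaryExtensive.vanKampen _ h)
    (BinaryCofan.mk (pullback.fst f i) (pullback.fst f j)) (pullback.snd f i) (pullback.snd f j) f
    pullback.condition.symm pullback.condition.symm).2
    ⟨.of_hasPullback f i, .of_hasPullback f j⟩

theorem box_tr_res_add {X Y Z : C} (i : X ⟶ Z) (j : Y ⟶ Z)
    (h : IsColimit (BinaryCofan.mk i j)) (z : BoxObj M N Z) :
    boxTransfer i (boxRestrict i z) + boxTransfer j (boxRestrict j z) = z := by
  refine DFunLike.congr_fun (f := (boxTransfer i).comp (boxRestrict i) +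
    (boxTransfer j).comp (boxRestrict j)) (g := AddMonoidHom.id _)
    (box_hom_ext fun U f m n => ?_) z
  obtain ⟨hc⟩ := isColimit_pullback h f
  rw [AddMonoidHom.add_apply, AddMonoidHom.comp_apply, AddMonoidHom.comp_apply,
    boxRestrict_boxTr (.of_hasPullback f i), boxRestrict_boxTr (.of_hasPullback f j),
    boxTransfer_boxTr, boxTransfer_boxTr, ← pullback.condition, ← pullback.condition,
    ← boxTr_frob_left, ← boxTr_frob_left, ← boxTr_add_left, M.tr_res_add _ _ hc]
  rfl

theorem box_bijective_res {X Y Z : C} (i : X ⟶ Z) (j : Y ⟶ Z)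
    (h : IsColimit (BinaryCofan.mk i j)) :
    Function.Bijective (fun z : BoxObj M N Z => (boxRestrict i z, boxRestrict j z)) := by
  have : Mono i := FinitaryExtensive.mono_inl_of_isColimit h
  have : Mono j := FinitaryExtensive.mono_inr_of_isColimit h
  have hp : IsPullback (initial.to X) (initial.to Y) i j :=
    FinitaryExtensive.isPullback_initial_to_binaryCofan h
  have h0 := box_subsingleton_initial (M := M) (N := N) (initialIsInitial (C := C))
  refine ⟨fun z w hzw => ?_, fun ⟨x, y⟩ => ⟨boxTransfer i x + boxTransfer j y, ?_⟩⟩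
  · rw [Prod.mk.injEq] at hzw
    rw [← box_tr_res_add i j h z, ← box_tr_res_add i j h w, hzw.1, hzw.2]
  · simp only [map_add, box_base_change (IsKernelPair.id_of_mono i),
      box_base_change (IsKernelPair.id_of_mono j), box_base_change hp, box_base_change hp.flip,
      boxRestrict_id_apply, boxTransfer_id_apply]
    rw [Subsingleton.elim (boxRestrict (initial.to X) x) 0,
      Subsingleton.elim (boxRestrict (initial.to Y) y) 0]
    simp

/-- The relative box product `M □_k N`. -/
noncomputable def box (M N : GreenModule k) : GreenModule k where
  obj := BoxObj M N
  grp := inferInstance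
  res := boxRestrict
  tr := boxTransfer
  res_id := boxRestrict_id_apply
  res_comp := boxRestrict_comp_apply
  tr_id := boxTransfer_id_apply
  tr_comp := boxTransfer_comp_apply
  base_change := box_base_change
  subsingleton_initial := box_subsingleton_initial
  bijective_res := box_bijective_res
  act :=
    { app := boxAct M N
      res_app := boxRestrict_boxAct
      tr_left := boxAct_tr_left
      tr_right := boxAct_tr_right }
  one_act := boxAct_one
  mul_act := boxAct_mul

/-- A pairing of `k`-modules that is `k`-bilinear, i.e. factors through the relative
box product. -/
structure Pairing (M N P : GreenModule k) extends
    MackeyFunctor.Pairing M.toMackeyFunctor N.toMackeyFunctor P.toMackeyFunctor where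
  act_left : ∀ {X : C} (a : k.obj X) (m : M.obj X) (n : N.obj X),
    app X (M.act.app X a m) n = P.act.app X a (app X m n)
  act_right : ∀ {X : C} (a : k.obj X) (m : M.obj X) (n : N.obj X),
    app X m (N.act.app X a n) = P.act.app X a (app X m n)

/-- The universal pairing `(m, n) ↦ m ⊗ n` of `M` and `N` into `M □_k N`. -/
noncomputable def boxPairing (M N : GreenModule k) : Pairing M N (box M N) where
  app X := AddMonoidHom.mk' (fun m => AddMonoidHom.mk' (fun n => boxTr (𝟙 X) m n)
    (boxTr_add_right _ m)) (fun m m' => AddMonoidHom.ext fun n => boxTr_add_left _ m m' n)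
  res_app f m n := by
    refine (boxRestrict_boxTr (p := f) (q := 𝟙 _) (.of_vert_isIso ⟨by simp⟩) m n)
  tr_left f m n :=
    ((boxTr_frob_left f (𝟙 _) m n).trans (by rw [Category.comp_id, Category.id_comp])).trans
      (boxTransfer_boxTr f (𝟙 _) m (N.res f n)).symm
  tr_right f m n :=
    ((boxTr_frob_right f (𝟙 _) m n).trans (by rw [Category.comp_id, Category.id_comp])).trans
      (boxTransfer_boxTr f (𝟙 _) (M.res f m) n).symm
  act_left a m n := by
    refine Eq.trans ?_ (boxAct_boxTr a (𝟙 _) m n).symm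
    rw [k.res_id]
    rfl
  act_right a m n := by
    refine Eq.trans (boxTr_balanced (𝟙 _) a m n).symm ?_
    refine Eq.trans ?_ (boxAct_boxTr a (𝟙 _) m n).symm
    rw [k.res_id]

/-- The element `m ⊗ n` of `(M □_k N)(X)`. -/
noncomputable def tmul {M N : GreenModule k} {X : C} (m : M.obj X) (n : N.obj X) :
    (box M N).obj X :=
  (boxPairing M N).app X m n

section tmul

variable {M N : GreenModule k} {X Y : C}

theorem add_tmul (m m' : M.obj X) (n : N.obj X) : tmul (m + m') n = tmul m n + tmul m' n := by
  simp [tmul]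

theorem tmul_add (m : M.obj X) (n n' : N.obj X) : tmul m (n + n') = tmul m n + tmul m n' := by
  simp [tmul]

theorem zero_tmul (n : N.obj X) : tmul (0 : M.obj X) n = 0 := by
  simp [tmul]

theorem neg_tmul (m : M.obj X) (n : N.obj X) : tmul (-m) n = -tmul m n := by
  simp [tmul]

theorem res_tmul (f : X ⟶ Y) (m : M.obj Y) (n : N.obj Y) :
    (box M N).res f (tmul m n) = tmul (M.res f m) (N.res f n) :=
  (boxPairing M N).res_app f m n

theorem tr_tmul (f : X ⟶ Y) (m : M.obj X) (n : N.obj Y) :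
    tmul (M.tr f m) n = (box M N).tr f (tmul m (N.res f n)) :=
  (boxPairing M N).tr_left f m n

theorem tmul_tr (f : X ⟶ Y) (m : M.obj Y) (n : N.obj X) :
    tmul m (N.tr f n) = (box M N).tr f (tmul (M.res f m) n) :=
  (boxPairing M N).tr_right f m n

theorem act_tmul (a : k.obj X) (m : M.obj X) (n : N.obj X) :
    tmul (M.act.app X a m) n = (box M N).act.app X a (tmul m n) :=
  (boxPairing M N).act_left a m n

theorem tmul_act (a : k.obj X) (m : M.obj X) (n : N.obj X) :
    tmul m (N.act.app X a n) = (box M N).act.app X a (tmul m n) :=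
  (boxPairing M N).act_right a m n

end tmul

theorem boxTr_eq_tr_tmul {M N : GreenModule k} {X Y : C} (f : Y ⟶ X) (m : M.obj Y) (n : N.obj Y) :
    (boxTr f m n : (box M N).obj X) = (box M N).tr f (tmul m n) :=
  ((boxTransfer_boxTr f (𝟙 _) m n).trans (by rw [Category.id_comp])).symm

/-- The cocone defining the map out of `(M □_k N)(X)` induced by a pairing. -/
def Pairing.cocone {M N P : GreenModule k} (β : Pairing M N P) (X : C) :
    BoxCocone M N X (P.obj X) where
  toFun {Y} f m n := P.tr f (β.app Y m n)
  add_left f m m' n := by simp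
  add_right f m n n' := by simp
  balanced f a m n := by rw [β.act_left, β.act_right]
  frob_left h f m n := by rw [β.tr_left, P.tr_comp]
  frob_right h f m n := by rw [β.tr_right, P.tr_comp]

theorem Pairing.desc_cocone_boxTr {M N P : GreenModule k} (β : Pairing M N P) {X Y : C}
    (f : Y ⟶ X) (m : M.obj Y) (n : N.obj Y) :
    (β.cocone X).desc (boxTr f m n) = P.tr f (β.app Y m n) :=
  BoxCocone.desc_boxTr _ _ _ _

/-- The universal property of the relative box product: the map `M □_k N ⟶ P` induced by a
`k`-bilinear pairing. -/
noncomputable def boxDesc {M N P : GreenModule k} (β : Pairing M N P) : box M N ⟶ P where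
  app X := (β.cocone X).desc
  app_res {X' X} g z := by
    refine DFunLike.congr_fun (f := AddMonoidHom.comp (β.cocone X').desc (boxRestrict g))
      (g := (P.res g).comp (β.cocone X).desc) (box_hom_ext fun Y f m n => ?_) z
    have h := IsPullback.of_hasPullback f g
    rw [AddMonoidHom.comp_apply, AddMonoidHom.comp_apply, boxRestrict_boxTr h,
      β.desc_cocone_boxTr, β.desc_cocone_boxTr, ← β.res_app, P.base_change h]
  app_tr {X X'} g z := by
    refine DFunLike.congr_fun (f := AddMonoidHom.comp (β.cocone X').desc (boxTransfer g))
      (g := (P.tr g).comp (β.cocone X).desc) (box_hom_ext fun Y f m n => ?_) z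
    rw [AddMonoidHom.comp_apply, AddMonoidHom.comp_apply, boxTransfer_boxTr,
      β.desc_cocone_boxTr, β.desc_cocone_boxTr, P.tr_comp]
  app_act {X} a z := by
    refine DFunLike.congr_fun (f := AddMonoidHom.comp (β.cocone X).desc (boxAct M N X a))
      (g := (P.act.app X a).comp (β.cocone X).desc) (box_hom_ext fun Y f m n => ?_) z
    rw [AddMonoidHom.comp_apply, AddMonoidHom.comp_apply, boxAct_boxTr,
      β.desc_cocone_boxTr, β.desc_cocone_boxTr, P.act.tr_right, β.act_left]

@[simp] theorem boxDesc_tmul {M N P : GreenModule k} (β : Pairing M N P) {X : C} (m : M.obj X)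
    (n : N.obj X) : Hom.app (boxDesc β) X (tmul m n) = β.app X m n :=
  (BoxCocone.desc_boxTr _ _ _ _).trans (P.tr_id _)

/-- To check a property of elements of the box product closed under addition, negation and
transfers, it suffices to check it on the elements `m ⊗ n`. -/
theorem tmul_induction {M N : GreenModule k} {motive : ∀ X, (box M N).obj X → Prop}
    (zero : ∀ X, motive X 0)
    (tmul : ∀ X (m : M.obj X) (n : N.obj X), motive X (tmul m n))
    (tr : ∀ (X Y : C) (f : X ⟶ Y) z, motive X z → motive Y ((box M N).tr f z))
    (neg : ∀ X z, motive X z → motive X (-z))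
    (add : ∀ X z w, motive X z → motive X w → motive X (z + w)) {X : C} (z : (box M N).obj X) :
    motive X z := by
  refine box_induction (motive := motive X) z (zero X) (fun Y f m n => ?_) (neg X) (add X)
  rw [boxTr_eq_tr_tmul]
  exact tr _ _ _ _ (tmul _ _ _)

theorem box_ext {M N P : GreenModule k} {f g : box M N ⟶ P}
    (h : ∀ X (m : M.obj X) (n : N.obj X), Hom.app f X (tmul m n) = Hom.app g X (tmul m n)) :
    f = g := by
  refine hom_ext fun X z => ?_
  induction z using tmul_induction with
  | zero X => simp
  | tmul X m n => exact h X m n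
  | tr X Y u z hz => rw [f.app_tr, g.app_tr, hz]
  | neg X z hz => simp [hz]
  | add X z w hz hw => simp [hz, hw]

theorem box_ext₃ {M N P Q : GreenModule k} {f g : box (box M N) P ⟶ Q}
    (h : ∀ X (m : M.obj X) (n : N.obj X) (p : P.obj X),
      Hom.app f X (tmul (tmul m n) p) = Hom.app g X (tmul (tmul m n) p)) : f = g := by
  refine box_ext fun X z => ?_
  induction z using tmul_induction with
  | zero X => simp [zero_tmul]
  | tmul X m n => exact h X m n
  | tr X Y u z hz => intro p; rw [tr_tmul, f.app_tr, g.app_tr, hz]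
  | neg X z hz => intro p; simp [neg_tmul, hz]
  | add X z w hz hw => intro p; simp [add_tmul, hz, hw]

theorem box_ext₄ {M N P Q T : GreenModule k} {f g : box (box (box M N) P) Q ⟶ T}
    (h : ∀ X (m : M.obj X) (n : N.obj X) (p : P.obj X) (q : Q.obj X),
      Hom.app f X (tmul (tmul (tmul m n) p) q) = Hom.app g X (tmul (tmul (tmul m n) p) q)) :
    f = g := by
  refine box_ext₃ fun X z => ?_
  induction z using tmul_induction with
  | zero X => simp [zero_tmul]
  | tmul X m n => exact h X m n
  | tr X Y u z hz => intro p q; rw [tr_tmul, tr_tmul, f.app_tr, g.app_tr, hz]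
  | neg X z hz => intro p q; simp [neg_tmul, hz]
  | add X z w hz hw => intro p q; simp [add_tmul, hz, hw]

/-- Precomposition of a pairing with morphisms. -/
def Pairing.comp {M N M' N' P : GreenModule k} (β : Pairing M' N' P) (f : M ⟶ M') (g : N ⟶ N') :
    Pairing M N P where
  app X := AddMonoidHom.mk' (fun m => (β.app X (Hom.app f X m)).comp (Hom.app g X))
    fun m m' => AddMonoidHom.ext fun n => by simp
  res_app h m n := by simp [f.app_res, g.app_res, β.res_app]
  tr_left h m n := by simp [f.app_tr, g.app_res, β.tr_left]
  tr_right h m n := by simp [f.app_res, g.app_tr, β.tr_right]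
  act_left a m n := by simp [f.app_act, β.act_left]
  act_right a m n := by simp [g.app_act, β.act_right]

/-- The pairing with the variables exchanged. -/
def Pairing.flip {M N P : GreenModule k} (β : Pairing M N P) : Pairing N M P where
  app X := (β.app X).flip
  res_app h m n := β.res_app h n m
  tr_left h m n := β.tr_right h n m
  tr_right h m n := β.tr_left h n m
  act_left a m n := β.act_right a n m
  act_right a m n := β.act_left a n m

/-- `f □_k g`, with `m ⊗ n ↦ f m ⊗ g n`. -/
noncomputable def boxMap {M N M' N' : GreenModule k} (f : M ⟶ M') (g : N ⟶ N') :
    box M N ⟶ box M' N' :=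
  boxDesc ((boxPairing M' N').comp f g)

@[simp] theorem boxMap_tmul {M N M' N' : GreenModule k} (f : M ⟶ M') (g : N ⟶ N') {X : C}
    (m : M.obj X) (n : N.obj X) :
    Hom.app (boxMap f g) X (tmul m n) = tmul (Hom.app f X m) (Hom.app g X n) :=
  boxDesc_tmul _ _ _

/-- The symmetry `m ⊗ n ↦ n ⊗ m`. -/
noncomputable def boxSwap (M N : GreenModule k) : box M N ⟶ box N M :=
  boxDesc (boxPairing N M).flip

@[simp] theorem boxSwap_tmul {M N : GreenModule k} {X : C} (m : M.obj X) (n : N.obj X) :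
    Hom.app (boxSwap M N) X (tmul m n) = tmul n m :=
  boxDesc_tmul _ _ _

/-- For fixed `p`, the map `tr_f (m ⊗ n) ↦ tr_f (m ⊗ (n ⊗ f^* p))`. -/
noncomputable def assocFun (M N P : GreenModule k) (X : C) (p : P.obj X) :
    BoxObj M N X →+ BoxObj M (box N P) X :=
  BoxCocone.desc
    { toFun := fun f m n => boxTr f m (tmul n (P.res f p))
      add_left := fun f m m' n => boxTr_add_left _ _ _ _
      add_right := fun f m n n' => by
        rw [add_tmul, boxTr_add_right]
      balanced := fun f a m n => by
        rw [boxTr_balanced, act_tmul]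
      frob_left := fun h f m n => by
        rw [boxTr_frob_left, res_tmul, P.res_comp]
      frob_right := fun h f m n => by
        rw [tr_tmul, boxTr_frob_right, P.res_comp] }

theorem assocFun_boxTr {M N P : GreenModule k} {X Y : C} (p : P.obj X) (f : Y ⟶ X) (m : M.obj Y)
    (n : N.obj Y) : assocFun M N P X p (boxTr f m n) = boxTr f m (tmul n (P.res f p)) :=
  BoxCocone.desc_boxTr _ _ _ _

/-- `assocFun` as a biadditive map. -/
noncomputable def assocHom (M N P : GreenModule k) (X : C) :
    BoxObj M N X →+ P.obj X →+ BoxObj M (box N P) X :=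
  AddMonoidHom.flip <| AddMonoidHom.mk' (assocFun M N P X) fun p p' =>
    box_hom_ext fun Y f m n => by
      rw [AddMonoidHom.add_apply, assocFun_boxTr, assocFun_boxTr, assocFun_boxTr, map_add, tmul_add,
        boxTr_add_right]

theorem assocHom_boxTr {M N P : GreenModule k} {X Y : C} (p : P.obj X) (f : Y ⟶ X) (m : M.obj Y)
    (n : N.obj Y) : assocHom M N P X (boxTr f m n) p = boxTr f m (tmul n (P.res f p)) :=
  assocFun_boxTr _ _ _ _

/-- The pairing `(m ⊗ n, p) ↦ m ⊗ (n ⊗ p)`. -/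
noncomputable def assocPairing (M N P : GreenModule k) :
    Pairing (box M N) P (box M (box N P)) where
  app := assocHom M N P
  res_app {X' X} g z p := by
    refine DFunLike.congr_fun (f := (boxRestrict g).comp ((assocHom M N P X).flip p))
      (g := ((assocHom M N P X').flip (P.res g p)).comp (boxRestrict g))
      (box_hom_ext fun Y f m n => ?_) z
    have h := IsPullback.of_hasPullback f g
    simp only [AddMonoidHom.comp_apply, AddMonoidHom.flip_apply]
    rw [assocHom_boxTr, boxRestrict_boxTr h, boxRestrict_boxTr h, assocHom_boxTr,
      res_tmul, ← P.res_comp, ← P.res_comp, h.w]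
  tr_left {X X'} g z p := by
    refine DFunLike.congr_fun (f := ((assocHom M N P X').flip p).comp (boxTransfer g))
      (g := (boxTransfer g).comp ((assocHom M N P X).flip (P.res g p)))
      (box_hom_ext fun Y f m n => ?_) z
    simp only [AddMonoidHom.comp_apply, AddMonoidHom.flip_apply]
    rw [boxTransfer_boxTr, assocHom_boxTr, assocHom_boxTr, boxTransfer_boxTr, P.res_comp]
  tr_right {X' X} g z p := by
    refine DFunLike.congr_fun (f := (assocHom M N P X).flip (P.tr g p))
      (g := (boxTransfer g).comp (((assocHom M N P X').flip p).comp (boxRestrict g)))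
      (box_hom_ext fun Y f m n => ?_) z
    have h := IsPullback.of_hasPullback f g
    simp only [AddMonoidHom.comp_apply, AddMonoidHom.flip_apply]
    rw [assocHom_boxTr, boxRestrict_boxTr h, assocHom_boxTr, boxTransfer_boxTr,
      P.base_change h.flip, tmul_tr, boxTr_frob_right, h.w]
  act_left {X} a z p := by
    refine DFunLike.congr_fun (f := ((assocHom M N P X).flip p).comp (boxAct M N X a))
      (g := (boxAct M (box N P) X a).comp ((assocHom M N P X).flip p))
      (box_hom_ext fun Y f m n => ?_) z
    simp only [AddMonoidHom.comp_apply, AddMonoidHom.flip_apply]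
    rw [boxAct_boxTr, assocHom_boxTr, assocHom_boxTr, boxAct_boxTr]
  act_right {X} a z p := by
    refine DFunLike.congr_fun (f := (assocHom M N P X).flip (P.act.app X a p))
      (g := (boxAct M (box N P) X a).comp ((assocHom M N P X).flip p))
      (box_hom_ext fun Y f m n => ?_) z
    simp only [AddMonoidHom.comp_apply, AddMonoidHom.flip_apply]
    rw [assocHom_boxTr, assocHom_boxTr, boxAct_boxTr, P.act.res_app,
      tmul_act, boxTr_balanced]

/-- The associativity map `(m ⊗ n) ⊗ p ↦ m ⊗ (n ⊗ p)`. -/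
noncomputable def boxAssocHom (M N P : GreenModule k) : box (box M N) P ⟶ box M (box N P) :=
  boxDesc (assocPairing M N P)

@[simp] theorem boxAssocHom_tmul {M N P : GreenModule k} {X : C} (m : M.obj X) (n : N.obj X)
    (p : P.obj X) :
    Hom.app (boxAssocHom M N P) X (tmul (tmul m n) p) = tmul m (tmul n p) :=
  (boxDesc_tmul _ _ _).trans <| (assocHom_boxTr p (𝟙 X) m n).trans <| by rw [P.res_id]; rfl

/-- The inverse associativity map `m ⊗ (n ⊗ p) ↦ (m ⊗ n) ⊗ p`. -/
noncomputable def boxAssocInv (M N P : GreenModule k) : box M (box N P) ⟶ box (box M N) P :=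
  boxSwap _ _ ≫ boxMap (boxSwap _ _) (𝟙 _) ≫ boxAssocHom P N M ≫ boxSwap _ _ ≫
    boxMap (boxSwap _ _) (𝟙 _)

@[simp] theorem boxAssocInv_tmul {M N P : GreenModule k} {X : C} (m : M.obj X) (n : N.obj X)
    (p : P.obj X) :
    Hom.app (boxAssocInv M N P) X (tmul m (tmul n p)) = tmul (tmul m n) p := by
  simp [boxAssocInv]

theorem box_swap_swap (M N : GreenModule k) : boxSwap M N ≫ boxSwap N M = 𝟙 _ :=
  box_ext fun X m n => by simp

theorem box_ext₃' {M N P Q : GreenModule k} {f g : box M (box N P) ⟶ Q}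
    (h : ∀ X (m : M.obj X) (n : N.obj X) (p : P.obj X),
      Hom.app f X (tmul m (tmul n p)) = Hom.app g X (tmul m (tmul n p))) : f = g := by
  have h' : boxSwap _ _ ≫ f = boxSwap _ _ ≫ g := box_ext₃ fun X n p m => by simpa using h X m n p
  rw [← Category.id_comp f, ← box_swap_swap, Category.assoc, h', ← Category.assoc, box_swap_swap,
    Category.id_comp]


/-- The associator of the relative box product. -/
@[simps]
noncomputable def boxAssoc (M N P : GreenModule k) : box (box M N) P ≅ box M (box N P) where
  hom := boxAssocHom M N P
  inv := boxAssocInv M N P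
  hom_inv_id := box_ext₃ fun X m n p => by simp
  inv_hom_id := box_ext₃' fun X m n p => by simp

/-- The action of `k` on `M` as a `k`-bilinear pairing. -/
def actPairing (M : GreenModule k) : Pairing (unit k) M M where
  toPairing := M.act
  act_left a b m := M.mul_act a b m
  act_right {X} a b m :=
    ((M.mul_act b a m).symm.trans (congrArg (fun z => M.act.app X z m) (k.mul_comm b a))).trans
      (M.mul_act a b m)

/-- The map `m ↦ 1 ⊗ m`. -/
noncomputable def unitInv (M : GreenModule k) : M ⟶ box (unit k) M where
  app X := (boxPairing (unit k) M).app X (k.one X)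
  app_res {X Y} f m := by
    have h := res_tmul (M := unit k) f (k.one Y) m
    exact (h.trans (congrArg (fun z => tmul (M := unit k) z (M.res f m)) (k.res_one f))).symm
  app_tr {X Y} f m := by
    have h := tmul_tr (M := unit k) f (k.one Y) m
    exact h.trans (congrArg (fun z => (box (unit k) M).tr f (tmul (M := unit k) z m)) (k.res_one f))
  app_act a m := tmul_act (M := unit k) a _ m

/-- The left unitor `a ⊗ m ↦ a m`. -/
@[simps]
noncomputable def boxLeftUnitor (M : GreenModule k) : box (unit k) M ≅ M where
  hom := boxDesc (actPairing M)
  inv := unitInv M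
  hom_inv_id := box_ext fun X a m => by
    rw [comp_app, boxDesc_tmul]
    have h1 := tmul_act (M := unit k) (N := M) a (k.one X) m
    have h2 := act_tmul (M := unit k) (N := M) a (k.one X) m
    exact (h1.trans h2.symm).trans
      (congrArg (fun z => tmul (M := unit k) z m) ((k.mul_comm a _).trans (k.one_mul a)))
  inv_hom_id := hom_ext fun X m => (boxDesc_tmul _ _ _).trans (M.one_act m)

@[simp] theorem boxLeftUnitor_tmul (M : GreenModule k) {X : C} (a : k.obj X) (m : M.obj X) :
    Hom.app (boxDesc (actPairing M)) X (tmul a m) = M.act.app X a m :=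
  boxDesc_tmul _ _ _

/-- The symmetry isomorphism. -/
@[simps]
noncomputable def boxBraiding (M N : GreenModule k) : box M N ≅ box N M where
  hom := boxSwap M N
  inv := boxSwap N M
  hom_inv_id := box_swap_swap M N
  inv_hom_id := box_swap_swap N M

/-- The monoidal structure on `k`-modules given by the relative box product, with unit `k`. -/
noncomputable instance : MonoidalCategoryStruct (GreenModule k) where
  tensorObj := box
  tensorHom := boxMap
  whiskerLeft M _ _ g := boxMap (𝟙 M) g
  whiskerRight f N := boxMap f (𝟙 N)
  tensorUnit := unit k
  associator := boxAssoc
  leftUnitor := boxLeftUnitor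
  rightUnitor M := boxBraiding M (unit k) ≪≫ boxLeftUnitor M

noncomputable instance : MonoidalCategory (GreenModule k) :=
  MonoidalCategory.ofTensorHom
    (id_tensorHom_id := fun M N => box_ext fun X m n => boxMap_tmul _ _ _ _)
    (id_tensorHom := fun _ _ _ _ => rfl)
    (tensorHom_id := fun _ _ => rfl)
    (tensorHom_comp_tensorHom := fun f₁ f₂ g₁ g₂ => by
      change boxMap f₁ f₂ ≫ boxMap g₁ g₂ = boxMap _ _
      exact box_ext fun X m n => by simp)
    (associator_naturality := fun f₁ f₂ f₃ => by
      change boxMap (boxMap f₁ f₂) f₃ ≫ boxAssocHom _ _ _ = boxAssocHom _ _ _ ≫ boxMap _ (boxMap _ _)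
      exact box_ext₃ fun X m n p => by simp)
    (leftUnitor_naturality := fun {M N} f => by
      change boxMap (𝟙 (unit k)) f ≫ boxDesc (actPairing N) = boxDesc (actPairing M) ≫ f
      exact box_ext fun X a m => by
        simp only [comp_app, boxMap_tmul, boxDesc_tmul, id_app]
        exact (f.app_act a m).symm)
    (rightUnitor_naturality := fun {M N} f => by
      change boxMap f (𝟙 (unit k)) ≫ boxSwap _ _ ≫ boxDesc (actPairing N) =
        (boxSwap _ _ ≫ boxDesc (actPairing M)) ≫ f
      exact box_ext fun X m a => by
        simp only [comp_app, boxMap_tmul, boxSwap_tmul, boxDesc_tmul, id_app]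
        exact (f.app_act a m).symm)
    (pentagon := fun M N P Q => by
      change boxMap (boxAssocHom M N P) (𝟙 Q) ≫ boxAssocHom M (box N P) Q ≫
        boxMap (𝟙 M) (boxAssocHom N P Q) = boxAssocHom (box M N) P Q ≫ boxAssocHom M N (box P Q)
      exact box_ext₄ fun X m n p q => by simp)
    (triangle := fun M N => by
      change boxAssocHom M (unit k) N ≫ boxMap (𝟙 M) (boxDesc (actPairing N)) =
        boxMap (boxSwap _ _ ≫ boxDesc (actPairing M)) (𝟙 N)
      refine box_ext₃ fun X m a n => ?_
      simp only [comp_app, boxAssocHom_tmul, boxMap_tmul, id_app, boxDesc_tmul, boxSwap_tmul]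
      exact (tmul_act a m n).trans (act_tmul a m n).symm)

noncomputable instance : SymmetricCategory (GreenModule k) where
  braiding := boxBraiding
  braiding_naturality_right M _ _ g := by
    change boxMap (𝟙 M) g ≫ boxSwap _ _ = boxSwap _ _ ≫ boxMap g (𝟙 M)
    exact box_ext fun X m n => by simp
  braiding_naturality_left f M := by
    change boxMap f (𝟙 M) ≫ boxSwap _ _ = boxSwap _ _ ≫ boxMap (𝟙 M) f
    exact box_ext fun X m n => by simp
  hexagon_forward M N P := by
    change boxAssocHom M N P ≫ boxSwap M (box N P) ≫ boxAssocHom N P M =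
      boxMap (boxSwap M N) (𝟙 P) ≫ boxAssocHom N M P ≫ boxMap (𝟙 N) (boxSwap M P)
    exact box_ext₃ fun X m n p => by simp
  hexagon_reverse M N P := by
    change boxAssocInv M N P ≫ boxSwap (box M N) P ≫ boxAssocInv P M N =
      boxMap (𝟙 M) (boxSwap N P) ≫ boxAssocInv M P N ≫ boxMap (boxSwap M P) (𝟙 N)
    exact box_ext₃' fun X m n p => by simp
  symmetry M N := box_swap_swap M N

end Box

end GreenModule

/-! ### Finite `G`-sets and coinduction from the trivial group -/

/-- The category of finite `G`-sets (underlying sets are taken in `Type`; since they are finite,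
this is up to equivalence no restriction, whatever the universe of `G`). -/
abbrev FinGSet (G : Type v) [Group G] : Type (max 1 v) := Action FintypeCat.{0} G

section Coinduction

variable (G : Type v) [Group G]

/-- The forgetful functor from finite `G`-sets to sets. -/
abbrev FinGSet.toType : FinGSet G ⥤ Type := Action.forget FintypeCat.{0} G ⋙ FintypeCat.incl

instance : FinitaryExtensive (FinGSet G) :=
  finitaryExtensive_of_preserves_and_reflects (FinGSet.toType G)

instance [Finite G] : EssentiallySmall.{0} (FinGSet G) := by
  rw [essentiallySmall_iff]
  refine ⟨?_, inferInstance⟩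
  let T := Σ n : ℕ, (G →* End (FintypeCat.of (Fin n)))
  have : ∀ n : ℕ, Small.{0} (G →* End (FintypeCat.of (Fin n))) := fun n =>
    small_of_injective (β := G → End (FintypeCat.of (Fin n))) DFunLike.coe_injective
  have : Small.{0} T := inferInstance
  let F : T → Skeleton (FinGSet G) := fun t => toSkeleton ⟨FintypeCat.of (Fin t.1), t.2⟩
  refine small_of_surjective (f := F) fun s => ?_
  obtain ⟨X, rfl⟩ : ∃ X, toSkeleton X = s := ⟨_, Quotient.out_eq s⟩
  obtain ⟨n, ⟨e⟩⟩ := Finite.exists_equiv_fin X.V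
  let i : X.V ≅ FintypeCat.of (Fin n) := FintypeCat.equivEquivIso e
  refine ⟨⟨n, i.conj.toMonoidHom.comp X.ρ⟩, ?_⟩
  refine toSkeleton_eq_toSkeleton_iff.2 ⟨Iso.symm (Action.mkIso (M := X)
    (N := ⟨FintypeCat.of (Fin n), i.conj.toMonoidHom.comp X.ρ⟩) i fun g => ?_)⟩
  simp [Iso.conj_apply]

variable {V W U : Type u} [AddCommGroup V] [AddCommGroup W] [AddCommGroup U]

/-- Summation along the fibres of a map out of a finite set. -/
noncomputable def fiberSum {A B : Type} [Finite A] (p : A → B) : (A → V) →+ (B → V) :=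
  AddMonoidHom.mk' (fun φ b => ∑ᶠ (a : A) (_ : p a = b), φ a) fun _ _ => funext fun b =>
    finsum_mem_add_distrib (s := {a | p a = b}) (Set.toFinite _)

theorem fiberSum_apply {A B : Type} [Finite A] (p : A → B) (φ : A → V) (b : B) :
    fiberSum p φ b = ∑ᶠ (a : A) (_ : p a = b), φ a := rfl

theorem fiberSum_eq_sum {A B : Type} [Fintype A] [DecidableEq B] (p : A → B) (φ : A → V) (b : B) :
    fiberSum p φ b = ∑ a, if p a = b then φ a else 0 := by
  rw [fiberSum_apply, finsum_eq_sum_of_fintype]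
  exact Finset.sum_congr rfl fun a _ => finsum_eq_if

theorem fiberSum_id {A : Type} [Finite A] (φ : A → V) : fiberSum id φ = φ := by
  classical
  have := Fintype.ofFinite A
  ext a
  simp [fiberSum_eq_sum]

theorem fiberSum_comp {A B D : Type} [Finite A] [Finite B] (p : A → B) (q : B → D) (φ : A → V) :
    fiberSum (q ∘ p) φ = fiberSum q (fiberSum p φ) := by
  classical
  have := Fintype.ofFinite A
  have := Fintype.ofFinite B
  ext d
  simp only [fiberSum_eq_sum, Function.comp_apply, ← Finset.sum_filter]
  rw [Finset.sum_comm' (t' := Finset.univ.filter fun a => q (p a) = d) (s' := fun a => {p a})]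
  · simp
  · intro b a
    simp only [Finset.mem_filter, Finset.mem_univ, true_and, Finset.mem_singleton]
    constructor
    · rintro ⟨h, rfl⟩
      exact ⟨rfl, h⟩
    · rintro ⟨rfl, h⟩
      exact ⟨h, rfl⟩

theorem fiberSum_base_change {A B D E : Type} [Finite A] [Finite B] {p : A → B} {q : A → D}
    {f : B → E} {g : D → E} (w : ∀ a, f (p a) = g (q a))
    (inj : ∀ a a', p a = p a' → q a = q a' → a = a')
    (surj : ∀ b d, f b = g d → ∃ a, p a = b ∧ q a = d) (φ : B → V) :
    (fiberSum f φ) ∘ g = fiberSum q (φ ∘ p) := by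
  ext d
  refine (finsum_mem_eq_of_bijOn (s := {a | q a = d}) (t := {b | f b = g d}) p ⟨?_, ?_, ?_⟩
    fun a _ => rfl).symm
  · rintro a rfl
    exact w a
  · rintro a ha a' ha' h
    exact inj a a' h (Eq.trans ha (Eq.symm ha'))
  · rintro b hb
    obtain ⟨a, rfl, rfl⟩ := surj b d hb
    exact ⟨a, rfl, rfl⟩

theorem map_fiberSum {A B : Type} [Finite A] (h : V →+ W) (p : A → B) (φ : A → V) (b : B) :
    h (fiberSum p φ b) = fiberSum p (fun a => h (φ a)) b := by
  classical
  have := Fintype.ofFinite A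
  rw [fiberSum_eq_sum, fiberSum_eq_sum, map_sum]
  exact Finset.sum_congr rfl fun a _ => by split_ifs <;> simp

theorem fiberSum_congr {A B : Type} [Finite A] (p : A → B) {φ ψ : A → V} {b : B}
    (h : ∀ a, p a = b → φ a = ψ a) : fiberSum p φ b = fiberSum p ψ b :=
  finsum_mem_congr (s := {a | p a = b}) rfl h

/-- Coinduction from the trivial group of an abelian group `V`: the Mackey functor
`X ↦ Fun(X, V)`, with restrictions given by precomposition and transfers by summation along
fibres. At `G/H` this is `Fun(G, V)^H`. -/
noncomputable def coindMackey (V : Type u) [AddCommGroup V] : MackeyFunctor.{u} (FinGSet G) where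
  obj X := X.V → V
  grp X := inferInstance
  res f := AddMonoidHom.mk' (fun φ x => φ (f.hom x)) fun _ _ => rfl
  tr f := fiberSum f.hom
  res_id _ := rfl
  res_comp _ _ _ := rfl
  tr_id m := fiberSum_id m
  tr_comp f g m := fiberSum_comp f.hom g.hom m
  base_change {W X Y Z p q f g} h m := by
    obtain ⟨-, inj, surj⟩ := (Types.isPullback_iff _ _ _ _).1 (h.map (FinGSet.toType G))
    refine fiberSum_base_change (p := p.hom) (q := q.hom) (f := f.hom) (g := g.hom) (fun a => ?_)
      (fun a a' h₁ h₂ => inj a a' ⟨h₁, h₂⟩) (fun b d hbd => surj b d hbd) m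
    exact ConcreteCategory.congr_hom (congrArg (FinGSet.toType G).map h.w) a
  subsingleton_initial {X} h := by
    have := (Types.initial_iff_empty _).1 ⟨h.isInitialObj (FinGSet.toType G) X⟩
    have : IsEmpty X.V := this
    exact inferInstanceAs (Subsingleton (X.V → V))
  bijective_res {X Y Z} i j h := by
    obtain ⟨hi, hj, hc⟩ := (Types.binaryCofan_isColimit_iff _).1
      ⟨mapIsColimitOfPreservesOfIsColimit (FinGSet.toType G) i j h⟩
    have hi' : Function.Injective i.hom := hi
    have hj' : Function.Injective j.hom := hj
    have hcov : ∀ z : Z.V, (∃ x, i.hom x = z) ∨ ∃ y, j.hom y = z := fun z => by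
      have : z ∈ Set.range i.hom ∪ Set.range j.hom := hc.sup_eq_top.ge (Set.mem_univ z)
      exact this
    have hdis : ∀ (x : X.V) (y : Y.V), i.hom x ≠ j.hom y := fun x y hxy =>
      Set.disjoint_left.1 hc.disjoint ⟨x, rfl⟩ ⟨y, hxy.symm⟩
    constructor
    · intro φ ψ hφ
      rw [Prod.mk.injEq] at hφ
      funext z
      rcases hcov z with ⟨x, rfl⟩ | ⟨y, rfl⟩
      · exact congrFun hφ.1 x
      · exact congrFun hφ.2 y
    · rintro ⟨φ, ψ⟩
      classical
      refine ⟨fun z => if hz : ∃ x, i.hom x = z then φ hz.choose else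
        if hz' : ∃ y, j.hom y = z then ψ hz'.choose else 0, Prod.ext (funext fun x => ?_)
        (funext fun y => ?_)⟩
      · have hx : ∃ x', i.hom x' = i.hom x := ⟨x, rfl⟩
        exact (dif_pos hx).trans (congrArg φ (hi' hx.choose_spec))
      · have hx : ¬ ∃ x', i.hom x' = j.hom y := fun ⟨x', h'⟩ => hdis _ _ h'
        have hy : ∃ y', j.hom y' = j.hom y := ⟨y, rfl⟩
        exact ((dif_neg hx).trans (dif_pos hy)).trans (congrArg ψ (hj' hy.choose_spec))

/-- The pointwise pairing of coinduced Mackey functors induced by a biadditive map. -/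
noncomputable def coindPairing (β : V →+ W →+ U) :
    MackeyFunctor.Pairing (coindMackey G V) (coindMackey G W) (coindMackey G U) where
  app X := AddMonoidHom.mk' (fun φ => AddMonoidHom.mk' (fun ψ x => β (φ x) (ψ x))
    fun ψ ψ' => funext fun x => map_add (β (φ x)) (ψ x) (ψ' x))
    fun φ φ' => AddMonoidHom.ext fun ψ => funext fun x => by
      change β (φ x + φ' x) (ψ x) = β (φ x) (ψ x) + β (φ' x) (ψ x)
      rw [map_add, AddMonoidHom.add_apply]
  res_app f l m := rfl
  tr_left {X Y} f l m := funext fun y =>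
    (map_fiberSum (β.flip (m y)) f.hom l y).trans
      (fiberSum_congr f.hom fun x h => congrArg (fun z => β (l x) (m z)) h.symm)
  tr_right {X Y} f l m := funext fun y =>
    (map_fiberSum (β (l y)) f.hom m y).trans
      (fiberSum_congr f.hom fun x h => congrArg (fun z => β (l z) (m x)) h.symm)

/-- The Green functor `C_e^G R` underlying the coinduction of a commutative ring `R`:
`X ↦ Fun(X, R)` with pointwise multiplication. -/
noncomputable def coindGreen (R : Type u) [CommRing R] : GreenFunctor.{u} (FinGSet G) where
  toMackeyFunctor := coindMackey G R
  mul := coindPairing G AddMonoidHom.mul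
  one _ := fun _ => 1
  res_one _ := rfl
  one_mul a := funext fun x => _root_.one_mul (a x)
  mul_comm a b := funext fun x => _root_.mul_comm (a x) (b x)
  mul_assoc a b c := funext fun x => _root_.mul_assoc (a x) (b x) (c x)

/-- The coinduction of an `R`-module `V`, as a module over `C_e^G R`. -/
noncomputable def coindModule (R : Type u) [CommRing R] (V : Type u) [AddCommGroup V] [Module R V] :
    GreenModule (coindGreen G R) where
  toMackeyFunctor := coindMackey G V
  act := coindPairing G (smulAddHom R V)
  one_act m := funext fun x => one_smul R (m x)
  mul_act a b m := funext fun x => mul_smul (a x) (b x) (m x)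

/-- Coinduction as a functor from `R`-modules to `C_e^G R`-modules. -/
noncomputable def coind (R : Type u) [CommRing R] :
    ModuleCat.{u} R ⥤ GreenModule (coindGreen G R) where
  obj V := coindModule G R V
  map {V W} f :=
    { app := fun X => AddMonoidHom.mk' (fun (φ : X.V → V) => (fun x => f.hom (φ x) : X.V → W))
        fun φ ψ => funext fun x => map_add f.hom (φ x) (ψ x)
      app_res := fun _ _ => rfl
      app_tr := fun g φ => funext fun y => map_fiberSum f.hom.toAddMonoidHom g.hom φ y
      app_act := fun a m => funext fun x => map_smul f.hom (a x) (m x) }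
  map_id _ := rfl
  map_comp _ _ := rfl

end Coinduction

/-! The value of `C_e^G R` at `X` consists of all functions on the underlying set of `X`, not only
the equivariant ones, so it contains the indicator `δ_x` of every point. These are orthogonal
idempotents with sum `1`, and they split `M(X)` into summands `δ_x M(X)`, for any module `M`. The
claim is that transfer to the one-point set `pt` identifies each summand with `M(pt)`, with inverse
`m ↦ δ_x res m`; hence `M(X) ≅ Fun(X, M(pt))`, and evaluation at `pt` is inverse to coinduction.

One composite is Frobenius reciprocity: `tr (δ_x res m) = tr(δ_x) m = m`, since `δ_x` transfers to
`1` (`tr_ind_act_res`). The other is the double coset formula for `X × X` with projections `p`, `q`: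
the sum over `x` of `δ_x res tr (δ_x m)` is `tr_q` of `p^* m` multiplied by `∑ p^* δ_x · q^* δ_x`.
That sum is the indicator of the diagonal, which is the transfer of `1` along the diagonal map
(`tr_diag`), so Frobenius reciprocity returns `m` (`sum_ind_act_res_tr`).

For the monoidal statement, the tensorator is the pointwise tensor product. Its inverse is the
extension, along the equivalence, of the map sending `v ⊗ w` to the product of two constant
functions at `pt`. The two are compared one idempotent at a time: after multiplication by `δ_x` a
function `φ` may be replaced by the constant `φ x`. The coherence conditions hold on elements `m ⊗
n`, which suffice to determine maps out of the box product. The structure on the inverse functor is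
then transported through the adjunction. -/

/-! ### Indicator functions and sums along fibres -/

section Indicator

variable {A B : Type} {R : Type u} [CommRing R]

open Classical in
/-- The indicator function of a point. -/
noncomputable def indicatorFun (R : Type u) [CommRing R] (x : A) : A → R :=
  fun y => if x = y then 1 else 0

theorem indicatorFun_mul (x : A) (a : A → R) (y : A) :
    indicatorFun R x y * a y = a x * indicatorFun R x y := by
  by_cases h : x = y
  · subst h; exact mul_comm _ _
  · simp [indicatorFun, h]

theorem sum_indicatorFun [Fintype A] (a : A) : ∑ x, indicatorFun R x a = 1 := by
  classical simp [indicatorFun, Finset.sum_ite_eq']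

theorem fiberSum_indicatorFun [Finite A] (p : A → B) (x : A) :
    fiberSum p (indicatorFun R x) = indicatorFun R (p x) := by
  classical
  funext y
  have := Fintype.ofFinite A
  rw [fiberSum_eq_sum, Finset.sum_eq_single x]
  · simp [indicatorFun]
  · intro b _ hb
    simp [indicatorFun, hb.symm]
  · simp

/-- Both sides are the indicator function of the image of `d`: the term at `a` is `1` exactly when
`p b = a = q b`, and joint injectivity of `p` and `q` then forces `b = d a`. -/
theorem fiberSum_one_of_diagonal [Fintype A] [Finite B] (d : A → B) (p q : B → A)
    (hp : ∀ a, p (d a) = a) (hq : ∀ a, q (d a) = a)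
    (inj : ∀ b b', p b = p b' → q b = q b' → b = b') (b : B) :
    fiberSum d (fun _ => (1 : R)) b =
      ∑ a, indicatorFun R a (p b) * indicatorFun R a (q b) := by
  classical
  rw [fiberSum_eq_sum]
  refine Finset.sum_congr rfl fun a _ => ?_
  by_cases h : d a = b
  · subst h
    simp [indicatorFun, hp, hq]
  · rw [if_neg h]
    by_cases h1 : a = p b
    · have h2 : a ≠ q b := fun h2 => h (inj _ _ ((hp a).trans h1) ((hq a).trans h2))
      simp [indicatorFun, h2]
    · simp [indicatorFun, h1]

/-- The hypothesis makes `L` linear, so this is expansion in the standard basis of `A → R`. It is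
phrased for additive maps because the actions and transfers to which it is applied are bundled that
way. -/
theorem AddMonoidHom.apply_eq_sum_indicatorFun [Fintype A] {P : Type*} [AddCommGroup P] [Module R P]
    (L : (A → R) →+ P) (hL : ∀ (r : R) (a : A → R), L (fun x => r * a x) = r • L a) (a : A → R) :
    L a = ∑ x, a x • L (indicatorFun R x) := by
  classical
  have h := LinearMap.pi_apply_eq_sum_univ (R := R)
    { toFun := L, map_add' := map_add L, map_smul' := hL } a
  refine h.trans (Finset.sum_congr rfl fun x _ => congrArg _ (congrArg L ?_))
  funext y
  simp only [indicatorFun]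

end Indicator

/-! ### The idempotents `δ_x` acting on a module, and its value at the point -/

section Evaluation

variable {G : Type v} [Group G] {R : Type u} [CommRing R]

namespace FinGSet

/-- The one-point `G`-set. -/
abbrev pt (G : Type v) [Group G] : FinGSet G := Action.trivial G (FintypeCat.of PUnit)

/-- The unique map from a finite `G`-set to the point. -/
def toPt (X : FinGSet G) : X ⟶ pt G where
  hom := FintypeCat.homMk fun _ => PUnit.unit
  comm _ := rfl

theorem comp_toPt {X Y : FinGSet G} (f : X ⟶ Y) : f ≫ toPt Y = toPt X := rfl

end FinGSet

namespace GreenModule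

open FinGSet

/-- The indicator function of a point, as an element of `C_e^G R`. -/
noncomputable def ind (R : Type u) [CommRing R] {X : FinGSet G} (x : X.V) :
    (coindGreen G R).obj X := indicatorFun R x

/-- A constant function, as an element of `C_e^G R`. -/
def const (X : FinGSet G) (r : R) : (coindGreen G R).obj X := fun _ => r

theorem const_add (X : FinGSet G) (r s : R) : const X (r + s) = const X r + const X s := rfl

theorem const_zero (X : FinGSet G) : const X (0 : R) = 0 := rfl

theorem tr_ind {X Y : FinGSet G} (f : X ⟶ Y) (x : X.V) :
    (coindGreen G R).tr f (ind R x) = ind R (f.hom x) :=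
  fiberSum_indicatorFun _ _

theorem tr_ind_pt {X : FinGSet G} (x : X.V) :
    (coindGreen G R).tr X.toPt (ind R x) = (coindGreen G R).one (pt G) :=
  (tr_ind _ x).trans (funext fun _ => if_pos (Subsingleton.elim (α := PUnit) _ _))

/-- The product sees only the value of `a` at `x`. Writing that value as a constant function allows
it to be pulled through the transfer to the point by `tr_pt_const_act`. -/
theorem ind_mul {X : FinGSet G} (x : X.V) (a : (coindGreen G R).obj X) :
    (coindGreen G R).mul.app X (ind R x) a =
      (coindGreen G R).mul.app X (const X (a x)) (ind R x) :=
  funext fun y => indicatorFun_mul x a y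

theorem ind_mul_self {X : FinGSet G} (x : X.V) :
    (coindGreen G R).mul.app X (ind R x) (ind R x) = ind R x :=
  (ind_mul x _).trans <| by
    rw [show const X (ind R x x) = (coindGreen G R).one X from funext fun _ => if_pos rfl,
      (coindGreen G R).one_mul]

theorem ind_mul_of_ne {X : FinGSet G} {x y : X.V} (h : x ≠ y) :
    (coindGreen G R).mul.app X (ind R x) (ind R y) = 0 :=
  (ind_mul x _).trans <| by
    rw [show const X (ind R y x) = 0 from funext fun _ => if_neg h.symm, map_zero]
    rfl

variable {M : GreenModule (coindGreen G R)}

/-- The `R`-module structure on the value of a `C_e^G R`-module at the point. -/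
noncomputable instance ptModule (M : GreenModule (coindGreen G R)) : Module R (M.obj (pt G)) where
  smul r m := M.act.app _ (const _ r) m
  one_smul m := M.one_act m
  mul_smul r s m := M.mul_act _ _ m
  smul_zero r := map_zero _
  smul_add r := map_add _
  add_smul r s m := by
    change M.act.app _ (const _ (r + s)) m = M.act.app _ (const _ r) m + M.act.app _ (const _ s) m
    rw [const_add, map_add, AddMonoidHom.add_apply]
  zero_smul m := by
    change M.act.app _ (const _ 0) m = 0
    rw [const_zero, map_zero, AddMonoidHom.zero_apply]

/-- A constant function on `X` is restricted from the point, so this is Frobenius reciprocity. -/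
theorem tr_pt_const_act {X : FinGSet G} (r : R) (m : M.obj X) :
    M.tr X.toPt (M.act.app X (const X r) m) = r • M.tr X.toPt m :=
  (M.act.tr_right X.toPt (const _ r) m).symm

theorem sum_ind_act {X : FinGSet G} [Fintype X.V] (m : M.obj X) :
    ∑ x : X.V, M.act.app X (ind R x) m = m := by
  have h : ∑ x : X.V, ind R x = (coindGreen G R).one X := by
    funext y
    refine Eq.trans ?_ (sum_indicatorFun (R := R) y)
    exact Finset.sum_apply (M := fun _ : X.V => R) y Finset.univ fun x => indicatorFun R x
  conv_rhs => rw [← M.one_act m, ← h, map_sum, AddMonoidHom.finsetSum_apply]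

/-- Since the `δ_x` sum to `1`, an element is determined by its components; equalities in the box
product are later checked this way. -/
theorem act_ind_eq_of_forall {X : FinGSet G} {m n : M.obj X}
    (h : ∀ x : X.V, M.act.app X (ind R x) m = M.act.app X (ind R x) n) : m = n := by
  have := Fintype.ofFinite X.V
  rw [← sum_ind_act m, ← sum_ind_act n]
  exact Finset.sum_congr rfl fun x _ => h x

/-- Here `P` is the product of `X` with itself and the lift is the diagonal map; both sides are the
indicator function of the diagonal. -/
theorem tr_diag {X P : FinGSet G} [Fintype X.V] {p q : P ⟶ X} (h : IsPullback p q X.toPt X.toPt) :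
    (coindGreen G R).tr (h.lift (𝟙 X) (𝟙 X) rfl) ((coindGreen G R).one X) =
      ∑ x : X.V, (coindGreen G R).mul.app P ((coindGreen G R).res p (ind R x))
        ((coindGreen G R).res q (ind R x)) := by
  obtain ⟨-, inj, -⟩ := (Types.isPullback_iff _ _ _ _).1 (h.map (FinGSet.toType G))
  funext b
  refine (fiberSum_one_of_diagonal (R := R) (h.lift (𝟙 X) (𝟙 X) rfl).hom p.hom q.hom
    (fun a => ?_) (fun a => ?_) (fun b b' h₁ h₂ => inj b b' ⟨h₁, h₂⟩) b).trans ?_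
  · exact ConcreteCategory.congr_hom (congrArg Action.Hom.hom (h.lift_fst (𝟙 X) (𝟙 X) rfl)) a
  · exact ConcreteCategory.congr_hom (congrArg Action.Hom.hom (h.lift_snd (𝟙 X) (𝟙 X) rfl)) a
  · exact (Finset.sum_apply (M := fun _ : P.V => R) b Finset.univ
      fun x y => indicatorFun R x (p.hom y) * indicatorFun R x (q.hom y)).symm

/-- Every element `m` is the sum over `x` of `δ_x` times the restriction of the transfer of `δ_x m`
to the point. -/
theorem sum_ind_act_res_tr {X : FinGSet G} [Fintype X.V] (m : M.obj X) :
    ∑ x : X.V, M.act.app X (ind R x)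
      (M.res X.toPt (M.tr X.toPt (M.act.app X (ind R x) m))) = m := by
  have h := IsPullback.of_hasPullback X.toPt X.toPt
  -- The double coset formula replaces `res ∘ tr` by a transfer along the second projection, and
  -- Frobenius reciprocity absorbs the outer `δ_x` into it.
  have key : ∀ x : X.V, M.act.app X (ind R x)
      (M.res X.toPt (M.tr X.toPt (M.act.app X (ind R x) m))) =
      M.tr (pullback.snd X.toPt X.toPt) (M.act.app _ ((coindGreen G R).mul.app _
        ((coindGreen G R).res (pullback.fst X.toPt X.toPt) (ind R x))
        ((coindGreen G R).res (pullback.snd X.toPt X.toPt) (ind R x))) (M.res (pullback.fst X.toPt X.toPt) m)) := by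
    intro x
    rw [M.base_change h, M.act.tr_right, M.act.res_app, ← M.mul_act, (coindGreen G R).mul_comm]
  -- Only the total over `x` simplifies: the idempotents add up to the transfer of `1` along the
  -- diagonal, and both projections compose with the diagonal to the identity.
  rw [Finset.sum_congr rfl fun x _ => key x, ← map_sum, ← AddMonoidHom.finsetSum_apply, ← map_sum,
    ← tr_diag h, M.act.tr_left, M.one_act, ← M.tr_comp, ← M.res_comp, h.lift_fst,
    h.lift_snd, M.res_id, M.tr_id]

end GreenModule
end Evaluation

/-! ### The equivalence between `R`-modules and `C_e^G R`-modules -/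

section CoindEquivalence

variable {G : Type v} [Group G] {R : Type u} [CommRing R]

namespace GreenModule

open FinGSet

/-- A morphism of modules with a levelwise inverse is an isomorphism. -/
@[simps]
def isoMk {C : Type v} [Category.{0} C] {k : GreenFunctor.{u} C} {M N : GreenModule k} (f : M ⟶ N)
    (g : ∀ X, N.obj X →+ M.obj X) (hfg : ∀ X m, g X (Hom.app f X m) = m)
    (hgf : ∀ X n, Hom.app f X (g X n) = n) : M ≅ N where
  hom := f
  inv :=
    { app := g
      app_res := fun h m => by
        conv_lhs => rw [← hgf _ m, ← Hom.app_res, hfg]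
      app_tr := fun h m => by
        conv_lhs => rw [← hgf _ m, ← Hom.app_tr, hfg]
      app_act := fun a m => by
        conv_lhs => rw [← hgf _ m, ← Hom.app_act, hfg] }
  hom_inv_id := hom_ext hfg
  inv_hom_id := hom_ext hgf

/-- Evaluation of `C_e^G R`-modules at the one-point `G`-set. -/
noncomputable def evalPt (G : Type v) [Group G] (R : Type u) [CommRing R] :
    GreenModule (coindGreen G R) ⥤ ModuleCat.{u} R where
  obj M := ModuleCat.of R (M.obj (pt G))
  map f := ModuleCat.ofHom
    { toFun := Hom.app f (pt G)
      map_add' := map_add _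
      map_smul' := fun r m => f.app_act (const _ r) m }
  map_id _ := rfl
  map_comp _ _ := rfl

/-- The map `m ↦ (x ↦ tr (δ_x m))` from a `C_e^G R`-module to the coinduction of its value at the
point. -/
noncomputable def toCoindEval (M : GreenModule (coindGreen G R)) :
    M ⟶ (coind G R).obj ((evalPt G R).obj M) where
  app X := AddMonoidHom.mk'
    (fun m => (fun x => M.tr X.toPt (M.act.app X (ind R x) m) : X.V → M.obj (pt G)))
    fun m n => funext fun x =>
      (congrArg (M.tr X.toPt) (map_add (M.act.app X (ind R x)) m n)).trans (map_add _ _ _)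
  app_res {X Y} f m := funext fun x => by
    change M.tr X.toPt (M.act.app X (ind R x) (M.res f m)) =
      M.tr Y.toPt (M.act.app Y (ind R (f.hom x)) m)
    -- By Frobenius reciprocity, `tr_f (δ_x res_f m) = tr_f(δ_x) m = δ_{f x} m`.
    rw [← comp_toPt f, M.tr_comp, ← M.act.tr_left, tr_ind]
  app_tr {X Y} f m := funext fun y => by
    classical
    have := Fintype.ofFinite X.V
    change M.tr Y.toPt (M.act.app Y (ind R y) (M.tr f m)) =
      fiberSum f.hom (fun x => M.tr X.toPt (M.act.app X (ind R x) m)) y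
    rw [M.act.tr_right, ← M.tr_comp, comp_toPt, fiberSum_eq_sum]
    -- Frobenius reciprocity has turned `δ_y` into `δ_y ∘ f`, the indicator of the fibre over `y`;
    -- expanding it in point indicators gives the sum along that fibre.
    refine (AddMonoidHom.apply_eq_sum_indicatorFun (R := R) (A := X.V)
      ((M.tr X.toPt).comp ((M.act.app X).flip m)) (fun r a => ?_) _).trans
      (Finset.sum_congr rfl fun x _ => ?_)
    · exact (congrArg (M.tr X.toPt) (M.mul_act (const X r) a m)).trans (tr_pt_const_act _ _)
    · change (if y = f.hom x then (1 : R) else 0) • M.tr X.toPt (M.act.app X (ind R x) m) = _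
      by_cases h : y = f.hom x
      · rw [if_pos h, if_pos h.symm, one_smul]
      · rw [if_neg h, if_neg (Ne.symm h), zero_smul]
  app_act {X} a m := funext fun x => by
    change M.tr X.toPt (M.act.app X (ind R x) (M.act.app X a m)) =
      a x • M.tr X.toPt (M.act.app X (ind R x) m)
    rw [← M.mul_act, ind_mul, M.mul_act, tr_pt_const_act]

/-- The map `φ ↦ ∑ x, δ_x res (φ x)` from the coinduction of the value of a `C_e^G R`-module at
the point. -/
noncomputable def ofCoindEval (M : GreenModule (coindGreen G R)) (X : FinGSet G) :
    ((coind G R).obj ((evalPt G R).obj M)).obj X →+ M.obj X :=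
  letI := Fintype.ofFinite X.V
  AddMonoidHom.mk' (fun (φ : X.V → M.obj (pt G)) =>
      ∑ x : X.V, M.act.app X (ind R x) (M.res X.toPt (φ x)))
    fun φ ψ => by
      rw [← Finset.sum_add_distrib]
      exact Finset.sum_congr rfl fun x _ =>
        (congrArg (M.act.app X (ind R x)) (map_add (M.res X.toPt) (φ x) (ψ x))).trans
          (map_add _ _ _)

/-- Orthogonality of the idempotents leaves only the summand at `x`. -/
theorem act_ind_ofCoindEval (M : GreenModule (coindGreen G R)) (X : FinGSet G)
    (φ : X.V → M.obj (pt G)) (x : X.V) :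
    M.act.app X (ind R x) (ofCoindEval M X φ) = M.act.app X (ind R x) (M.res X.toPt (φ x)) := by
  let := Fintype.ofFinite X.V
  change M.act.app X (ind R x) (∑ y : X.V, M.act.app X (ind R y) (M.res X.toPt (φ y))) = _
  rw [map_sum, Finset.sum_eq_single x, ← M.mul_act, ind_mul_self]
  · intro y _ h
    rw [← M.mul_act, ind_mul_of_ne h.symm, map_zero, AddMonoidHom.zero_apply]
  · simp

/-- Frobenius reciprocity moves the transfer onto `δ_x`, where it gives `1`. -/
theorem tr_ind_act_res {M : GreenModule (coindGreen G R)} {X : FinGSet G} (x : X.V)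
    (m : M.obj (pt G)) : M.tr X.toPt (M.act.app X (ind R x) (M.res X.toPt m)) = m := by
  rw [← M.act.tr_left, tr_ind_pt, M.one_act]

/-- Every `C_e^G R`-module is coinduced from its value at the point. -/
noncomputable def coindEvalIso (M : GreenModule (coindGreen G R)) :
    (coind G R).obj ((evalPt G R).obj M) ≅ M :=
  -- Compatibility with the structure maps is checked only for `toCoindEval`; a levelwise inverse
  -- inherits it.
  (isoMk (toCoindEval M) (ofCoindEval M) (fun X m =>
      letI := Fintype.ofFinite X.V
      sum_ind_act_res_tr m)
    fun X φ => funext fun x =>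
      (congrArg (M.tr X.toPt) (act_ind_ofCoindEval M X φ x)).trans
        (tr_ind_act_res x (φ x))).symm

theorem act_ind_coindEvalIso_hom (M : GreenModule (coindGreen G R)) (X : FinGSet G)
    (φ : X.V → M.obj (pt G)) (x : X.V) :
    M.act.app X (ind R x) (Hom.app (coindEvalIso M).hom X φ) =
      M.act.app X (ind R x) (M.res X.toPt (φ x)) :=
  act_ind_ofCoindEval M X φ x

/-- The transfer to the point sums `δ_x φ` over all of `X`, and only the term at `x` survives. This
is the triangle identity of the adjoint equivalence. -/
theorem toCoindEval_coind (V : ModuleCat.{u} R) (X : FinGSet G) (φ : X.V → V) (x : X.V) :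
    Hom.app (toCoindEval ((coind G R).obj V)) X φ x = fun _ : (pt G).V => φ x := by
  classical
  have := Fintype.ofFinite X.V
  funext y
  refine (fiberSum_eq_sum X.toPt.hom (fun z => indicatorFun R x z • φ z) y).trans ?_
  rw [Finset.sum_eq_single x]
  · exact (if_pos rfl).trans ((congrArg (· • φ x) (if_pos rfl)).trans (one_smul R _))
  · intro z _ h
    have h' : indicatorFun R x z = 0 := if_neg h.symm
    rw [h', zero_smul, ite_self]
  · exact fun h => (h (Finset.mem_univ x)).elim

theorem coind_act_ind_congr (V : ModuleCat.{u} R) {X : FinGSet G} (x : X.V) {φ ψ : X.V → V}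
    (h : φ x = ψ x) :
    ((coind G R).obj V).act.app X (ind R x) φ = ((coind G R).obj V).act.app X (ind R x) ψ :=
  funext fun y => by
    change indicatorFun R x y • φ y = indicatorFun R x y • ψ y
    by_cases hy : x = y
    · subst hy
      rw [h]
    · rw [show indicatorFun R x y = 0 from if_neg hy, zero_smul, zero_smul]

/-- A module is the value at the point of its coinduction. -/
noncomputable def evalCoindIso (G : Type v) [Group G] {R : Type u} [CommRing R]
    (V : ModuleCat.{u} R) : V ≅ (evalPt G R).obj ((coind G R).obj V) :=
  LinearEquiv.toModuleIso (X₂ := ((coind G R).obj V).obj (pt G))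
    { toFun := fun v _ => v
      invFun := fun φ => φ PUnit.unit
      map_add' := fun _ _ => rfl
      map_smul' := fun _ _ => rfl
      left_inv := fun _ => rfl
      right_inv := fun _ => rfl }

/-- Coinduction is an equivalence between `R`-modules and `C_e^G R`-modules. -/
noncomputable def coindEquivalence (G : Type v) [Group G] (R : Type u) [CommRing R] :
    ModuleCat.{u} R ≌ GreenModule (coindGreen G R) where
  functor := coind G R
  inverse := evalPt G R
  unitIso := NatIso.ofComponents (evalCoindIso G) fun _ =>
    ModuleCat.hom_ext (LinearMap.ext fun _ => rfl)
  counitIso := (NatIso.ofComponents (fun M => (coindEvalIso M).symm) fun {M N} f =>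
    hom_ext fun X m => funext fun x => by
      change N.tr X.toPt (N.act.app X (ind R x) (Hom.app f X m)) =
        Hom.app f (pt G) (M.tr X.toPt (M.act.app X (ind R x) m))
      rw [f.app_tr, f.app_act]).symm
  functor_unitIso_comp V := by
    change (coind G R).map (evalCoindIso G V).hom ≫ (coindEvalIso _).hom = 𝟙 _
    -- The inverse of the counit is the explicit map `toCoindEval`, so the identity is moved to that
    -- side.
    rw [← Iso.eq_comp_inv, Category.id_comp]
    exact hom_ext fun X φ => funext fun x => (toCoindEval_coind V X φ x).symm

end GreenModule
end CoindEquivalence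

/-! ### Coinduction as a strong symmetric monoidal functor -/

section CoindMonoidal

variable {G : Type v} [Group G] [Finite G] {R : Type u} [CommRing R]

namespace GreenModule

open FinGSet

open scoped TensorProduct

/-- The pointwise tensor product of functions, as a bilinear pairing of `C_e^G R`-modules. -/
noncomputable def coindTensorPairing (G : Type v) [Group G] {R : Type u} [CommRing R]
    (V W : ModuleCat.{u} R) :
    Pairing ((coind G R).obj V) ((coind G R).obj W) ((coind G R).obj (V ⊗ W)) where
  toPairing := coindPairing G (U := V ⊗[R] W) <|
    AddMonoidHom.mk' (fun v : V => (TensorProduct.mk R V W v).toAddMonoidHom) fun v v' =>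
      AddMonoidHom.ext fun w => TensorProduct.add_tmul v v' w
  act_left a φ ψ := funext fun x => TensorProduct.smul_tmul' (a x) (φ x) (ψ x)
  act_right a φ ψ := funext fun x => TensorProduct.tmul_smul (a x) (φ x) (ψ x)

/-- The tensorator of coinduction. -/
noncomputable def coindμ (G : Type v) [Group G] [Finite G] {R : Type u} [CommRing R]
    (V W : ModuleCat.{u} R) :
    box ((coind G R).obj V) ((coind G R).obj W) ⟶ (coind G R).obj (V ⊗ W) :=
  boxDesc (coindTensorPairing G V W)

theorem coindμ_tmul (V W : ModuleCat.{u} R) {X : FinGSet G} (φ : X.V → V) (ψ : X.V → W) :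
    Hom.app (coindμ G V W) X
      (tmul (M := (coind G R).obj V) (N := (coind G R).obj W) φ ψ) =
      (fun x => φ x ⊗ₜ[R] ψ x : X.V → V ⊗[R] W) :=
  boxDesc_tmul _ _ _

/-- The map `v ⊗ w ↦ v ⊗ w` from the tensor product to the box product at the point. -/
noncomputable def tensorToBox (G : Type v) [Group G] [Finite G] {R : Type u} [CommRing R]
    (V W : ModuleCat.{u} R) :
    V ⊗[R] W →ₗ[R] (box ((coind G R).obj V) ((coind G R).obj W)).obj (pt G) :=
  TensorProduct.lift <| LinearMap.mk₂ R
    (fun v w => tmul (M := (coind G R).obj V) (N := (coind G R).obj W) (X := pt G)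
      (fun _ => v) (fun _ => w))
    (fun v v' w => add_tmul (M := (coind G R).obj V) (N := (coind G R).obj W) (X := pt G)
      (fun _ => v) (fun _ => v') (fun _ => w))
    (fun r v w => act_tmul (M := (coind G R).obj V) (N := (coind G R).obj W) (const (pt G) r)
      (fun _ => v) (fun _ => w))
    (fun v w w' => tmul_add (M := (coind G R).obj V) (N := (coind G R).obj W) (X := pt G)
      (fun _ => v) (fun _ => w) (fun _ => w'))
    (fun r v w => tmul_act (M := (coind G R).obj V) (N := (coind G R).obj W) (const (pt G) r)
      (fun _ => v) (fun _ => w))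

theorem tensorToBox_tmul (V W : ModuleCat.{u} R) (v : V) (w : W) :
    tensorToBox G V W (v ⊗ₜ w) =
      tmul (M := (coind G R).obj V) (N := (coind G R).obj W) (X := pt G)
      (fun _ => v) (fun _ => w) := rfl

/-- This is one half of the invertibility of the tensorator at the point; `inv_hom_id` in
`coindμIso` reduces to it at every `X`. -/
theorem coindμ_tensorToBox (V W : ModuleCat.{u} R) (t : V ⊗[R] W) :
    Hom.app (coindμ G V W) (pt G) (tensorToBox G V W t) = (fun _ => t : (pt G).V → V ⊗[R] W) := by
  induction t using TensorProduct.induction_on with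
  | zero => rw [map_zero, map_zero]; rfl
  | tmul v w => exact coindμ_tmul V W _ _
  | add s t hs ht => rw [map_add, map_add, hs, ht]; rfl

/-- The inverse of the tensorator of coinduction. -/
noncomputable def coindδ (G : Type v) [Group G] [Finite G] {R : Type u} [CommRing R]
    (V W : ModuleCat.{u} R) :
    (coind G R).obj (V ⊗ W) ⟶ box ((coind G R).obj V) ((coind G R).obj W) :=
  -- The box product is itself coinduced from its value at the point, so a linear map into that
  -- value is enough to define the morphism.
  (coind G R).map (X := ModuleCat.of R (V ⊗[R] W))
    (Y := (evalPt G R).obj (box ((coind G R).obj V) ((coind G R).obj W)))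
    (ModuleCat.ofHom (tensorToBox G V W)) ≫ (coindEvalIso _).hom

theorem act_ind_coindδ (V W : ModuleCat.{u} R) (X : FinGSet G) (φ : X.V → V ⊗[R] W) (x : X.V) :
    (box ((coind G R).obj V) ((coind G R).obj W)).act.app X (ind R x)
      (Hom.app (coindδ G V W) X φ) =
    (box ((coind G R).obj V) ((coind G R).obj W)).act.app X (ind R x)
      ((box ((coind G R).obj V) ((coind G R).obj W)).res X.toPt (tensorToBox G V W (φ x))) :=
  act_ind_coindEvalIso_hom _ X _ x

/-- Idempotence supplies two copies of `δ_x`, and bilinearity sends one to each factor. -/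
theorem act_ind_tmul {M N : GreenModule (coindGreen G R)} {X : FinGSet G} (x : X.V) (m : M.obj X)
    (n : N.obj X) : (box M N).act.app X (ind R x) (tmul m n) =
      tmul (M.act.app X (ind R x) m) (N.act.app X (ind R x) n) := by
  conv_lhs => rw [← ind_mul_self, mul_act, ← tmul_act, ← act_tmul]

/-- The tensorator of coinduction, as an isomorphism. -/
noncomputable def coindμIso (G : Type v) [Group G] [Finite G] {R : Type u} [CommRing R]
    (V W : ModuleCat.{u} R) :
    box ((coind G R).obj V) ((coind G R).obj W) ≅ (coind G R).obj (V ⊗ W) where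
  hom := coindμ G V W
  inv := coindδ G V W
  hom_inv_id := box_ext fun X φ ψ => act_ind_eq_of_forall fun x => by
    rw [comp_app, id_app]
    refine (act_ind_coindδ V W X _ x).trans ?_
    rw [show Hom.app (coindμ G V W) X (tmul φ ψ) = _ from coindμ_tmul V W φ ψ, tensorToBox_tmul]
    -- What remains compares `φ ⊗ ψ` with the product of the constants `φ x` and `ψ x`, after
    -- multiplication by `δ_x`. Once `δ_x` acts on each factor separately, a function and its value
    -- at `x` become indistinguishable.
    refine (congrArg _ (res_tmul X.toPt _ _)).trans ((act_ind_tmul x _ _).trans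
      (Eq.trans ?_ (act_ind_tmul x _ _).symm))
    exact congrArg₂ (fun z w => tmul (M := (coind G R).obj V) (N := (coind G R).obj W) z w)
      (coind_act_ind_congr V x rfl) (coind_act_ind_congr W x rfl)
  inv_hom_id := hom_ext fun X φ => act_ind_eq_of_forall fun x => by
    rw [comp_app, id_app, ← Hom.app_act]
    -- As `coindμ` is linear and commutes with restriction, it can be moved past `δ_x` and `res`
    -- down to the point.
    refine (congrArg (Hom.app (coindμ G V W) X) (act_ind_coindδ V W X φ x)).trans ?_
    rw [Hom.app_act, Hom.app_res, coindμ_tensorToBox]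
    exact coind_act_ind_congr _ x rfl

/-- Coinduction takes the unit to the unit. -/
noncomputable def coindεIso (G : Type v) [Group G] (R : Type u) [CommRing R] :
    unit (coindGreen G R) ≅ (coind G R).obj (𝟙_ (ModuleCat.{u} R)) where
  hom := ⟨fun _ => AddMonoidHom.id _, fun _ _ => rfl, fun _ _ => rfl, fun _ _ => rfl⟩
  inv := ⟨fun _ => AddMonoidHom.id _, fun _ _ => rfl, fun _ _ => rfl, fun _ _ => rfl⟩

/-- Coinduction is strong monoidal. -/
noncomputable def coindCoreMonoidal (G : Type v) [Group G] [Finite G] (R : Type u) [CommRing R] :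
    (coind G R).CoreMonoidal where
  εIso := coindεIso G R
  μIso := coindμIso G
  μIso_hom_natural_left {V V'} f W := by
    -- In this and the following fields both sides are maps out of a box product. On elements `m ⊗
    -- n` the tensorator is a pointwise tensor, and the two sides agree definitionally.
    change boxMap _ (𝟙 _) ≫ coindμ G V' W = coindμ G V W ≫ (coind G R).map (f ▷ W)
    refine box_ext fun X φ ψ => ?_
    rw [comp_app, comp_app, boxMap_tmul]
    erw [coindμ_tmul, coindμ_tmul]
    rfl
  μIso_hom_natural_right {V V'} W f := by
    change boxMap (𝟙 _) _ ≫ coindμ G W V' = coindμ G W V ≫ (coind G R).map (W ◁ f)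
    refine box_ext fun X φ ψ => ?_
    rw [comp_app, comp_app, boxMap_tmul]
    erw [coindμ_tmul, coindμ_tmul]
    rfl
  associativity U V W := by
    change boxMap (coindμ G U V) (𝟙 _) ≫ coindμ G (U ⊗ V) W ≫ (coind G R).map (α_ U V W).hom =
      boxAssocHom _ _ _ ≫ boxMap (𝟙 _) (coindμ G V W) ≫ coindμ G U (V ⊗ W)
    refine box_ext₃ fun X φ ψ χ => ?_
    simp only [comp_app, boxMap_tmul, boxAssocHom_tmul]
    erw [coindμ_tmul, coindμ_tmul, coindμ_tmul, coindμ_tmul]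
    rfl
  left_unitality V := by
    change boxDesc (actPairing _) =
      boxMap (coindεIso G R).hom (𝟙 _) ≫ coindμ G (𝟙_ _) V ≫ (coind G R).map (λ_ V).hom
    refine box_ext fun X a φ => ?_
    rw [comp_app, comp_app, boxMap_tmul, boxDesc_tmul]
    erw [coindμ_tmul]
    rfl
  right_unitality V := by
    change boxSwap _ _ ≫ boxDesc (actPairing _) =
      boxMap (𝟙 _) (coindεIso G R).hom ≫ coindμ G V (𝟙_ _) ≫ (coind G R).map (ρ_ V).hom
    refine box_ext fun X φ a => ?_
    rw [comp_app, comp_app, comp_app, boxMap_tmul, boxSwap_tmul, boxDesc_tmul]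
    erw [coindμ_tmul]
    rfl

/-- Coinduction is strong symmetric monoidal. -/
@[reducible]
noncomputable def coindBraided (G : Type v) [Group G] [Finite G] (R : Type u) [CommRing R] :
    (coind G R).Braided :=
  { (coindCoreMonoidal G R).toMonoidal with
    braided := fun V W => by
      change coindμ G V W ≫ (coind G R).map (β_ V W).hom = boxSwap _ _ ≫ coindμ G W V
      refine box_ext fun X φ ψ => ?_
      rw [comp_app, comp_app, boxSwap_tmul]
      erw [coindμ_tmul, coindμ_tmul]
      rfl }

end GreenModule

end CoindMonoidal

/-! ### Transport of the structure to the inverse functor, and the conclusion -/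

/-- The inverse of a braided monoidal equivalence, with the induced monoidal structure, is
braided. -/
@[reducible]
noncomputable def CategoryTheory.Equivalence.inverseBraided {C D : Type*} [Category* C] [Category* D]
    [MonoidalCategory C] [MonoidalCategory D] [BraidedCategory C] [BraidedCategory D] (e : C ≌ D)
    [e.functor.Braided] : e.inverse.Braided :=
  { e.inverseMonoidal with
    braided := fun X Y => by
      -- The tensorator of the inverse is a transpose under the adjunction. Naturality of
      -- transposition reduces the claim to the braiding compatibility of `e.functor`.
      change e.toAdjunction.homEquiv _ _ _ ≫ _ = _ ≫ e.toAdjunction.homEquiv _ _ _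
      rw [← Adjunction.homEquiv_naturality_right, ← Adjunction.homEquiv_naturality_left]
      simp }

/-- For a finite group `G` and a commutative ring `R`, coinduction is (the functor part of) an
adjoint equivalence between `R`-modules and modules over the Green functor `C_e^G R`, and this
adjoint equivalence is strong symmetric monoidal for `⊗_R` and the relative box product. -/
theorem mainTheorem6 (G : Type v) [Group G] [Finite G] (R : Type u) [CommRing R] :
    ∃ e : ModuleCat.{u} R ≌ GreenModule (coindGreen G R), e.functor = coind G R ∧
      ∃ (_ : e.functor.Braided) (_ : e.inverse.Braided), e.IsMonoidal := by
  let e : ModuleCat.{u} R ≌ _ := GreenModule.coindEquivalence G R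
  let : e.functor.Braided := GreenModule.coindBraided G R
  -- The lax structure on the inverse is the one induced by the adjunction; with this choice the
  -- unit and counit are monoidal.
  let := e.toAdjunction.rightAdjointLaxMonoidal
  exact ⟨e, rfl, inferInstance, e.inverseBraided,
    inferInstanceAs e.toAdjunction.IsMonoidal⟩
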